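/- There are absolute constants $c_0,\gamma,C>0$ such that the following holds for all positive integers $n,m$ with $m\ge c_0 n$. Let $\mathbb{K}=\mathbb{R}$ or $\mathbb{K}=\mathbb{C}$, and let $a_1,\dots,a_m$ be independent, identically distributed random vectors in $\mathbb{K}^n$ with one of the following distributions: if $\mathbb{K}=\mathbb{R}$, the normal distribution $\mathcal{N}(0,I_n)$ or the uniform distribution on the sphere of radius $\sqrt{n}$ in $\mathbb{R}^n$; if $\mathbb{K}=\mathbb{C}$, the complex normal distribution $\mathcal{N}(0,I_n/2)+i\,\mathcal{N}(0,I_n/2)$ (with independent real and imaginary parts) or the uniform distribution on the sphere of radius $\sqrt{n}$ in $\mathbb{C}^n$. Then there is an event of probability at least $1-Ce^{-\gamma m}$ on which, for every $x_0\in\mathbb{K}^n$ simultaneously, the semidefinite program (PhaseLift) \[ \text{minimize } \operatorname{tr}(X)\quad\text{subject to}\quad X\succeq 0,\quad \operatorname{tr}(a_ia_i^*X)=b_i,\ i=1,\dots,m, \] over Hermitian matrices $X\in\mathbb{K}^{n\times n}$ (real symmetric if $\mathbb{K}=\mathbb{R}$), with data $b_i=|\langle a_i,x_0\rangle|^2$,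 has the unique solution $X=x_0x_0^*$. -/

import Mathlib

open MeasureTheory ProbabilityTheory
open scoped ComplexOrder

noncomputable section

namespace PhaseLift

/-- The rank-one matrix `x x^*`. -/
def rankOne {𝕜 : Type*} [RCLike 𝕜] {n : ℕ} (x : EuclideanSpace 𝕜 (Fin n)) :
    Matrix (Fin n) (Fin n) 𝕜 :=
  Matrix.vecMulVec x.ofLp (star x.ofLp)

/-- The noiseless quadratic measurements `b_i = |⟨a_i, x₀⟩|²`. -/
def measurements {𝕜 : Type*} [RCLike 𝕜] {n m : ℕ} (a : Fin m → EuclideanSpace 𝕜 (Fin n))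
    (x₀ : EuclideanSpace 𝕜 (Fin n)) (i : Fin m) : ℝ :=
  ‖inner 𝕜 (a i) x₀‖ ^ 2

/-- The feasible set of PhaseLift: `X ⪰ 0` (which includes that `X` is Hermitian, i.e. symmetric
over the reals) and `tr(a_i a_i^* X) = b_i` for all `i`. -/
def feasibleSet {𝕜 : Type*} [RCLike 𝕜] {n m : ℕ} (a : Fin m → EuclideanSpace 𝕜 (Fin n))
    (b : Fin m → ℝ) : Set (Matrix (Fin n) (Fin n) 𝕜) :=
  {X | X.PosSemidef ∧ ∀ i, (rankOne (a i) * X).trace = (b i : 𝕜)}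

/-- `X` solves PhaseLift: it is feasible and has minimal trace among the feasible matrices.
The trace of a positive semidefinite matrix is real, so `RCLike.re` only changes the type. -/
def IsSolution {𝕜 : Type*} [RCLike 𝕜] {n m : ℕ} (a : Fin m → EuclideanSpace 𝕜 (Fin n))
    (b : Fin m → ℝ) (X : Matrix (Fin n) (Fin n) 𝕜) : Prop :=
  X ∈ feasibleSet a b ∧ IsMinOn (fun Z => RCLike.re Z.trace) (feasibleSet a b) X

/-- PhaseLift is exact at `x₀`: the program with data `b_i = |⟨a_i, x₀⟩|²` has one and only one
solution, namely `x₀ x₀^*`. -/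
def IsExact {𝕜 : Type*} [RCLike 𝕜] {n m : ℕ} (a : Fin m → EuclideanSpace 𝕜 (Fin n))
    (x₀ : EuclideanSpace 𝕜 (Fin n)) : Prop :=
  ∀ X, IsSolution a (measurements a x₀) X ↔ X = rankOne x₀

/-- The uniform distribution on the sphere of radius `r` about the origin of `E`: the surface
measure of the unit sphere, normalized to total mass one and dilated by `r`. -/
def uniformSphere (E : Type*) [NormedAddCommGroup E] [NormedSpace ℝ E] [MeasureSpace E] (r : ℝ) :
    Measure E :=
  (((volume : Measure E).toSphere Set.univ)⁻¹ • (volume : Measure E).toSphere).map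
    (fun u : Metric.sphere (0 : E) 1 => r • (u : E))

/-- The complex normal distribution `N(0, I_n/2) + i N(0, I_n/2)`, with independent real and
imaginary parts. -/
def complexGaussian (n : ℕ) : Measure (EuclideanSpace ℂ (Fin n)) :=
  ((multivariateGaussian 0 ((1 / 2 : ℝ) • (1 : Matrix (Fin n) (Fin n) ℝ))).prod
    (multivariateGaussian 0 ((1 / 2 : ℝ) • (1 : Matrix (Fin n) (Fin n) ℝ)))).map
    (fun p => WithLp.toLp 2 (fun k => (p.1 k : ℂ) + Complex.I * (p.2 k : ℂ)))

/-- The real models: `N(0, I_n)`, or uniform on the sphere of radius `√n` in `ℝⁿ`. -/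
def IsRealModel (n : ℕ) (μ : Measure (EuclideanSpace ℝ (Fin n))) : Prop :=
  μ = multivariateGaussian 0 1 ∨ μ = uniformSphere (EuclideanSpace ℝ (Fin n)) (Real.sqrt n)

/-- The complex models: `N(0, I_n/2) + i N(0, I_n/2)`, or uniform on the sphere of radius `√n`
in `ℂⁿ`. -/
def IsComplexModel (n : ℕ) (μ : Measure (EuclideanSpace ℂ (Fin n))) : Prop :=
  μ = complexGaussian n ∨ μ = uniformSphere (EuclideanSpace ℂ (Fin n)) (Real.sqrt n)

/-- With probability at least `1 - δ`, PhaseLift is exact for all `x₀` simultaneously. -/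
def ExactForAllWithProbability {𝕜 : Type*} [RCLike 𝕜] {n m : ℕ} {Ω : Type*} [MeasurableSpace Ω]
    (P : Measure Ω) (a : Fin m → Ω → EuclideanSpace 𝕜 (Fin n)) (δ : ℝ) : Prop :=
  ∃ S : Set Ω, MeasurableSet S ∧ 1 - δ ≤ P.real S ∧
    ∀ ω ∈ S, ∀ x₀ : EuclideanSpace 𝕜 (Fin n), IsExact (fun i => a i ω) x₀

end PhaseLift

end

/-! The trace objective plays no role: with overwhelming probability, for every x₀ the only feasible
matrix is x₀x₀*. Let z = x₀/‖x₀‖ and let X = B*B be feasible, with b_k the conjugated rows of B.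
Splitting each b_k along z and zᗮ writes X - x₀x₀* as uz* + zu* + ∑ v_k v_k*, with v_k ⟂ z. All
measurements of this difference vanish. Since ∑ v_k v_k* is positive semidefinite, an upper frame
bound on it and an ℓ¹ lower bound on the tangent term give ‖u‖ ≲ τ := ∑ ‖v_k‖². Pairing instead with
an approximate dual certificate ∑ w_i a_i a_i*, close to a positive multiple of the projection onto
zᗮ, gives τ ≲ δ‖u‖. For small δ both vanish (`IsRegular.eq_smul`, `IsRegular.isExact`).

The weights are w_i = β - min(|⟨a_i,z⟩|², 1), with β chosen so that the certificate has mean zero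
along z; its mean on zᗮ is then a positive multiple of the identity
(`IsIsotropic.integral_certificate`, `IsScalarModel.certGap_pos`). The weights are bounded and
Lipschitz in ⟨a_i,z⟩, so each quadratic form of the certificate has an exponential moment, and it
can be controlled when z moves. Chernoff bounds on nets of pairs of unit vectors, followed by
perturbation, give the three properties for all z at once (`exists_regular_event`), hence exactness
for all x₀ on a single event. The constants depend only on the law of one coordinate, not on the
dimension.

This needs only that coordinates in orthonormal directions have a fixed law and are pairwise
independent, which Gaussian characteristic functions provide. Coordinates on the sphere are not
independent, so the spherical models are reduced to the Gaussian ones: a Gaussian vector is a random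
radius times an independent uniform direction, exactness is unaffected by nonzero real rescalings of
the a_i, and by Fubini some fixed choice of radii has failure probability at most the average
(`exists_scaling_uniformSphere`). -/

namespace PhaseLift

/-! ### Deterministic recovery from the frame, tangent and certificate bounds. -/

section Deterministic

variable {𝕜 E : Type*} [RCLike 𝕜] [NormedAddCommGroup E] [InnerProductSpace 𝕜 E]

/-- The deterministic properties of the measurement vectors from which exact recovery follows:
an upper frame bound, an `ℓ¹` lower bound on the tangent directions at `z zᴴ`, and an approximate
dual certificate `∑ w z i • a i (a i)ᴴ` close to a multiple of the projection onto `zᗮ`. -/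
structure IsRegular {m : ℕ} (a : Fin m → E) (w : E → Fin m → ℝ) (c₁ c₂ δ : ℝ) : Prop where
  frame : ∀ v : E, ∑ i, ‖inner 𝕜 (a i) v‖ ^ 2 ≤ m * (8 * ‖v‖ ^ 2)
  tangent : ∀ z u : E, ‖z‖ = 1 → ‖u‖ = 1 → RCLike.im (inner 𝕜 z u) = 0 →
    m * c₁ ≤ ∑ i, |RCLike.re (inner 𝕜 (a i) u * inner 𝕜 z (a i))|
  certificate : ∀ z v : E, ‖z‖ = 1 → ‖v‖ = 1 →
    |∑ i, w z i * ‖inner 𝕜 (a i) v‖ ^ 2 - m * (c₂ * (1 - ‖inner 𝕜 v z‖ ^ 2))| ≤ m * δ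

variable {m : ℕ} {a : Fin m → E} {w : E → Fin m → ℝ} {c₁ c₂ δ : ℝ}

theorem IsRegular.certificate_hom (h : IsRegular (𝕜 := 𝕜) a w c₁ c₂ δ) {z : E} (hz : ‖z‖ = 1)
    (v : E) :
    |∑ i, w z i * ‖inner 𝕜 (a i) v‖ ^ 2 - m * (c₂ * (‖v‖ ^ 2 - ‖inner 𝕜 v z‖ ^ 2))|
      ≤ m * δ * ‖v‖ ^ 2 := by
  rcases eq_or_ne v 0 with rfl | hv
  · simp
  have hn : ‖v‖ ≠ 0 := norm_ne_zero_iff.2 hv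
  set v' : E := ((‖v‖⁻¹ : ℝ) : 𝕜) • v with hv'
  have hv1 : ‖v'‖ = 1 := by
    rw [hv', norm_smul]; simp [hn]
  have hvv : v = ((‖v‖ : ℝ) : 𝕜) • v' := by
    rw [hv', smul_smul, ← RCLike.ofReal_mul, mul_inv_cancel₀ hn]; simp
  have key := h.certificate z v' hz hv1
  have e1 : ∀ i, ‖inner 𝕜 (a i) v‖ ^ 2 = ‖v‖ ^ 2 * ‖inner 𝕜 (a i) v'‖ ^ 2 := fun i => by
    conv_lhs => rw [hvv, inner_smul_right, norm_mul]
    simp [mul_pow]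
  have e2 : ‖inner 𝕜 v z‖ ^ 2 = ‖v‖ ^ 2 * ‖inner 𝕜 v' z‖ ^ 2 := by
    conv_lhs => rw [hvv, inner_smul_left, norm_mul]
    simp [mul_pow]
  have e3 : ∑ i, w z i * ‖inner 𝕜 (a i) v‖ ^ 2 - m * (c₂ * (‖v‖ ^ 2 - ‖inner 𝕜 v z‖ ^ 2))
      = ‖v‖ ^ 2 * (∑ i, w z i * ‖inner 𝕜 (a i) v'‖ ^ 2
        - m * (c₂ * (1 - ‖inner 𝕜 v' z‖ ^ 2))) := by
    rw [e2, mul_sub (‖v‖ ^ 2), Finset.mul_sum]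
    congr 1
    · exact Finset.sum_congr rfl fun i _ => by rw [e1]; ring
    · ring
  rw [e3, abs_mul, abs_of_nonneg (sq_nonneg _), mul_comm]
  exact mul_le_mul_of_nonneg_right key (sq_nonneg _)

theorem IsRegular.tangent_hom (h : IsRegular (𝕜 := 𝕜) a w c₁ c₂ δ) {z : E} (hz : ‖z‖ = 1)
    {u : E} (hu : RCLike.im (inner 𝕜 z u) = 0) :
    m * c₁ * ‖u‖ ≤ ∑ i, |RCLike.re (inner 𝕜 (a i) u * inner 𝕜 z (a i))| := by
  rcases eq_or_ne u 0 with rfl | hv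
  · simp
  have hn : ‖u‖ ≠ 0 := norm_ne_zero_iff.2 hv
  set v' : E := ((‖u‖⁻¹ : ℝ) : 𝕜) • u with hv'
  have hv1 : ‖v'‖ = 1 := by
    rw [hv', norm_smul]; simp [hn]
  have hvv : u = ((‖u‖ : ℝ) : 𝕜) • v' := by
    rw [hv', smul_smul, ← RCLike.ofReal_mul, mul_inv_cancel₀ hn]; simp
  have him : RCLike.im (inner 𝕜 z v') = 0 := by
    rw [hv', inner_smul_right, RCLike.im_ofReal_mul, hu, mul_zero]
  have key := h.tangent z v' hz hv1 him
  have e1 : ∀ i, |RCLike.re (inner 𝕜 (a i) u * inner 𝕜 z (a i))|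
      = |RCLike.re (inner 𝕜 (a i) v' * inner 𝕜 z (a i))| * ‖u‖ := fun i => by
    conv_lhs => rw [hvv, inner_smul_right, mul_assoc, RCLike.re_ofReal_mul, abs_mul, abs_norm]
    ring
  rw [Finset.sum_congr rfl fun i _ => e1 i, ← Finset.sum_mul]
  exact mul_le_mul_of_nonneg_right key (norm_nonneg _)

theorem two_mul_re_eq_norm_sq_sub (x y : 𝕜) :
    2 * RCLike.re (x * star y) = (‖x + y‖ ^ 2 - ‖x - y‖ ^ 2) / 2 := by
  have h1 : ‖x + y‖ ^ 2 = ‖x‖ ^ 2 + 2 * RCLike.re (x * star y) + ‖y‖ ^ 2 := by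
    rw [@norm_add_sq 𝕜, RCLike.inner_apply', ← RCLike.conj_re]; simp [mul_comm]
  have h2 : ‖x - y‖ ^ 2 = ‖x‖ ^ 2 - 2 * RCLike.re (x * star y) + ‖y‖ ^ 2 := by
    rw [@norm_sub_sq 𝕜, RCLike.inner_apply', ← RCLike.conj_re]; simp [mul_comm]
  rw [h1, h2]; ring

/-- Polarization. The target form ‖v‖² - |⟨v,z⟩|² ignores the z-component, so it agrees at v' + z
and v' - z and cancels in the difference. What remains is half the sum of the two errors, δ(‖v' +
z‖² + ‖v' - z‖²)/2 = 2δ. -/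
theorem IsRegular.certificate_cross (h : IsRegular (𝕜 := 𝕜) a w c₁ c₂ δ) {z : E} (hz : ‖z‖ = 1)
    (u : E) :
    |∑ i, w z i * (2 * RCLike.re (inner 𝕜 (a i) u * inner 𝕜 z (a i)))|
      ≤ m * (2 * δ) * ‖u‖ := by
  rcases eq_or_ne u 0 with rfl | hv
  · simp
  have hn : ‖u‖ ≠ 0 := norm_ne_zero_iff.2 hv
  set v' : E := ((‖u‖⁻¹ : ℝ) : 𝕜) • u with hv'
  have hv1 : ‖v'‖ = 1 := by
    rw [hv', norm_smul]; simp [hn]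
  have hvv : u = ((‖u‖ : ℝ) : 𝕜) • v' := by
    rw [hv', smul_smul, ← RCLike.ofReal_mul, mul_inv_cancel₀ hn]; simp
  have hp := h.certificate_hom hz (v' + z)
  have hm := h.certificate_hom hz (v' - z)
  have n1 : ‖v' + z‖ ^ 2 = 1 + 2 * RCLike.re (inner 𝕜 v' z) + 1 := by
    rw [@norm_add_sq 𝕜, hv1, hz]; norm_num
  have n2 : ‖v' - z‖ ^ 2 = 1 - 2 * RCLike.re (inner 𝕜 v' z) + 1 := by
    rw [@norm_sub_sq 𝕜, hv1, hz]; norm_num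
  have zz : inner 𝕜 z z = (1 : 𝕜) := by rw [inner_self_eq_norm_sq_to_K, hz]; simp
  have n3 : ‖inner 𝕜 (v' + z) z‖ ^ 2
      = ‖inner 𝕜 v' z‖ ^ 2 + 2 * RCLike.re (inner 𝕜 v' z) + 1 := by
    rw [inner_add_left, zz, @norm_add_sq 𝕜, RCLike.inner_apply']; simp [inner_re_symm z]
  have n4 : ‖inner 𝕜 (v' - z) z‖ ^ 2
      = ‖inner 𝕜 v' z‖ ^ 2 - 2 * RCLike.re (inner 𝕜 v' z) + 1 := by
    rw [inner_sub_left, zz, @norm_sub_sq 𝕜, RCLike.inner_apply']; simp [inner_re_symm z]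
  rw [n1, n3] at hp
  rw [n2, n4] at hm
  have e1 : ∀ i, w z i * (2 * RCLike.re (inner 𝕜 (a i) u * inner 𝕜 z (a i)))
      = ‖u‖ * ((w z i * ‖inner 𝕜 (a i) (v' + z)‖ ^ 2
        - w z i * ‖inner 𝕜 (a i) (v' - z)‖ ^ 2) / 2) := fun i => by
    have := two_mul_re_eq_norm_sq_sub (inner 𝕜 (a i) v') (inner 𝕜 (a i) z)
    rw [inner_add_right, inner_sub_right]
    conv_lhs => rw [hvv, inner_smul_right, mul_assoc, RCLike.re_ofReal_mul]
    rw [← inner_conj_symm z (a i)]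
    simp only [RCLike.star_def] at this
    rw [show w z i * (2 * (‖u‖ * RCLike.re (inner 𝕜 (a i) v'
      * (starRingEnd 𝕜) (inner 𝕜 (a i) z)))) = ‖u‖ * (w z i * (2 * RCLike.re (inner 𝕜 (a i) v'
      * (starRingEnd 𝕜) (inner 𝕜 (a i) z)))) by ring, this]
    ring
  rw [Finset.sum_congr rfl fun i _ => e1 i, ← Finset.mul_sum, ← Finset.sum_div,
    Finset.sum_sub_distrib, abs_mul, abs_norm, mul_comm]
  refine mul_le_mul_of_nonneg_right ?_ (norm_nonneg _)
  rw [abs_le] at hp hm ⊢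
  constructor <;> nlinarith [hp.1, hp.2, hm.1, hm.2]

/-- Expansion of a quadratic form `∑ |⟨b k, x⟩|² - t |⟨z, x⟩|²` along `z` and `zᗮ`. -/
theorem sum_norm_inner_sq_expand {ι : Type*} [Fintype ι] (b : ι → E) (t : ℝ) (z x : E) :
    ∑ k, ‖inner 𝕜 (b k) x‖ ^ 2 - t * ‖inner 𝕜 z x‖ ^ 2
      = ∑ k, ‖inner 𝕜 x (b k - inner 𝕜 z (b k) • z)‖ ^ 2
        + 2 * RCLike.re (inner 𝕜 x (∑ k, inner 𝕜 (b k) z • (b k - inner 𝕜 z (b k) • z)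
          + (((∑ k, ‖inner 𝕜 (b k) z‖ ^ 2 - t) / 2 : ℝ) : 𝕜) • z) * inner 𝕜 z x) := by
  set y := inner 𝕜 z x with hy
  have hxz : inner 𝕜 x z = star y := by rw [hy, RCLike.star_def, inner_conj_symm]
  have hyy : RCLike.re (star y * y) = ‖y‖ ^ 2 := by
    rw [RCLike.star_def, RCLike.conj_mul]; norm_cast
  rw [inner_add_right, inner_sum, add_mul, map_add, inner_smul_right, hxz, Finset.sum_mul, map_sum,
    mul_assoc, RCLike.re_ofReal_mul, hyy]
  have hk : ∀ k, ‖inner 𝕜 (b k) x‖ ^ 2 = ‖inner 𝕜 x (b k - inner 𝕜 z (b k) • z)‖ ^ 2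
      + 2 * RCLike.re (inner 𝕜 x (inner 𝕜 (b k) z • (b k - inner 𝕜 z (b k) • z)) * y)
      + ‖inner 𝕜 (b k) z‖ ^ 2 * ‖y‖ ^ 2 := fun k => by
    set v := b k - inner 𝕜 z (b k) • z with hv
    have h1 : inner 𝕜 x (b k) = inner 𝕜 x v + inner 𝕜 z (b k) * star y := by
      rw [hv, inner_sub_right, inner_smul_right, hxz]; ring
    rw [norm_inner_symm (𝕜 := 𝕜) (b k) x, h1, @norm_add_sq 𝕜, RCLike.inner_apply', norm_mul,
      norm_star, mul_pow, norm_inner_symm (𝕜 := 𝕜) z (b k), inner_smul_right]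
    congr 2
    rw [← RCLike.conj_re]
    simp only [map_mul, RCLike.conj_conj, RCLike.star_def, inner_conj_symm]
    congr 1
    rw [← inner_conj_symm (b k) z]
    simp
    ring_nf
  rw [Finset.sum_congr rfl fun k _ => hk k, Finset.sum_add_distrib, Finset.sum_add_distrib,
    ← Finset.sum_mul, ← Finset.mul_sum]
  ring

/-- The tangent bound at z = u = v/‖v‖ is violated otherwise. This serves x₀ = 0, where no direction
z is available. -/
theorem IsRegular.eq_zero (h : IsRegular (𝕜 := 𝕜) a w c₁ c₂ δ) (hm : 0 < m) (hc₁ : 0 < c₁)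
    {v : E} (hv : ∀ i, ‖inner 𝕜 v (a i)‖ = 0) : v = 0 := by
  by_contra hne
  have hn : ‖v‖ ≠ 0 := norm_ne_zero_iff.2 hne
  have key := h.tangent (((‖v‖⁻¹ : ℝ) : 𝕜) • v) (((‖v‖⁻¹ : ℝ) : 𝕜) • v)
    (by rw [norm_smul]; simp [hn]) (by rw [norm_smul]; simp [hn]) (inner_self_im _)
  have h0 : ∀ i, inner 𝕜 v (a i) = 0 := fun i => norm_eq_zero.1 (hv i)
  have : (∑ i, |RCLike.re (inner 𝕜 (a i) (((‖v‖⁻¹ : ℝ) : 𝕜) • v)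
      * inner 𝕜 (((‖v‖⁻¹ : ℝ) : 𝕜) • v) (a i))|) = 0 :=
    Finset.sum_eq_zero fun i _ => by rw [inner_smul_left, h0 i]; simp
  rw [this] at key
  have : (0 : ℝ) < m := by exact_mod_cast hm
  nlinarith [mul_pos this hc₁]

/-- The core duality argument. With τ the trace of the part on zᗮ, the frame and tangent bounds give
‖u‖ ≤ (4/c₁)τ, while the certificate gives (c₂ - δ)τ ≤ 2δ‖u‖. Together (c₂ - δ(1 + 8/c₁))τ ≤ 0, so τ
= 0 and then u = 0. -/
theorem IsRegular.eq_smul (h : IsRegular (𝕜 := 𝕜) a w c₁ c₂ δ) (hm : 0 < m) (hc₁ : 0 < c₁)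
    (hδ : 0 ≤ δ) (hc₂ : δ * (1 + 8 / c₁) < c₂) {ι : Type*} [Fintype ι] {b : ι → E} {t : ℝ} {z : E}
    (hz : ‖z‖ = 1) (hb : ∀ i, ∑ k, ‖inner 𝕜 (b k) (a i)‖ ^ 2 = t * ‖inner 𝕜 z (a i)‖ ^ 2) :
    (∀ k, b k = inner 𝕜 z (b k) • z) ∧ ∑ k, ‖inner 𝕜 (b k) z‖ ^ 2 = t := by
  have hm' : (0 : ℝ) < m := by exact_mod_cast hm
  have zz : inner 𝕜 z z = (1 : 𝕜) := by rw [inner_self_eq_norm_sq_to_K, hz]; simp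
  set v : ι → E := fun k => b k - inner 𝕜 z (b k) • z with hv
  -- The coefficient of z is halved because it occurs in both uz* and zu*. It is real, as the
  -- tangent bound requires.
  set u : E := ∑ k, inner 𝕜 (b k) z • v k
    + (((∑ k, ‖inner 𝕜 (b k) z‖ ^ 2 - t) / 2 : ℝ) : 𝕜) • z with hu
  have hvz : ∀ k, inner 𝕜 z (v k) = 0 := fun k => by
    simp only [hv, inner_sub_right, inner_smul_right, zz]; ring
  have hzu : inner 𝕜 z u = (((∑ k, ‖inner 𝕜 (b k) z‖ ^ 2 - t) / 2 : ℝ) : 𝕜) := by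
    rw [hu, inner_add_right, inner_sum, inner_smul_right, zz, mul_one]
    simp [inner_smul_right, hvz]
  have hid : ∀ i, ∑ k, ‖inner 𝕜 (a i) (v k)‖ ^ 2
      + 2 * RCLike.re (inner 𝕜 (a i) u * inner 𝕜 z (a i)) = 0 := fun i => by
    rw [← sum_norm_inner_sq_expand, hb i, sub_self]
  set τ : ℝ := ∑ k, ‖v k‖ ^ 2 with hτ
  have hτ0 : 0 ≤ τ := Finset.sum_nonneg fun _ _ => sq_nonneg _
  have hub : 2 * (m * c₁ * ‖u‖) ≤ m * (8 * τ) := by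
    calc 2 * (m * c₁ * ‖u‖)
        ≤ 2 * ∑ i, |RCLike.re (inner 𝕜 (a i) u * inner 𝕜 z (a i))| := by
          gcongr; exact h.tangent_hom hz (by rw [hzu, RCLike.ofReal_im])
      _ = ∑ i, ∑ k, ‖inner 𝕜 (a i) (v k)‖ ^ 2 := by
          rw [Finset.mul_sum]
          -- Each tangent measurement is minus a sum of squares, so its absolute value is exactly
          -- that sum.
          refine Finset.sum_congr rfl fun i _ => ?_
          have h0 : 0 ≤ ∑ k, ‖inner 𝕜 (a i) (v k)‖ ^ 2 := Finset.sum_nonneg fun _ _ => sq_nonneg _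
          have := hid i
          rw [abs_of_nonpos (by linarith)]
          linarith
      _ = ∑ k, ∑ i, ‖inner 𝕜 (a i) (v k)‖ ^ 2 := Finset.sum_comm
      _ ≤ ∑ k, m * (8 * ‖v k‖ ^ 2) := Finset.sum_le_sum fun k _ => h.frame (v k)
      _ = m * (8 * τ) := by rw [← Finset.mul_sum, ← Finset.mul_sum]
  have hcert : m * (c₂ - δ) * τ ≤ ∑ i, w z i * ∑ k, ‖inner 𝕜 (a i) (v k)‖ ^ 2 := by
    simp_rw [Finset.mul_sum]
    rw [Finset.sum_comm, hτ, Finset.mul_sum]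
    refine Finset.sum_le_sum fun k _ => ?_
    have := h.certificate_hom hz (v k)
    rw [norm_inner_symm (𝕜 := 𝕜), hvz k, norm_zero, abs_le] at this
    nlinarith [this.1]
  have hcross := h.certificate_cross hz u
  have hsum : ∑ i, w z i * ∑ k, ‖inner 𝕜 (a i) (v k)‖ ^ 2
      + ∑ i, w z i * (2 * RCLike.re (inner 𝕜 (a i) u * inner 𝕜 z (a i))) = 0 := by
    rw [← Finset.sum_add_distrib]
    exact Finset.sum_eq_zero fun i _ => by rw [← mul_add, hid i, mul_zero]
  have hub' : ‖u‖ ≤ 4 / c₁ * τ := by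
    rw [div_mul_eq_mul_div, le_div_iff₀ hc₁]
    nlinarith [mul_le_mul_of_nonneg_left hub (inv_nonneg.2 hm'.le), inv_mul_cancel₀ hm'.ne']
  have hfin : (c₂ - δ) * τ ≤ 2 * δ * ‖u‖ := by
    rw [abs_le] at hcross
    have : m * ((c₂ - δ) * τ) ≤ m * (2 * δ * ‖u‖) := by linarith [hcross.1]
    exact le_of_mul_le_mul_left this hm'
  have hτz : τ = 0 := by
    by_contra hne
    have hτp : 0 < τ := lt_of_le_of_ne hτ0 (Ne.symm hne)
    have h1 : 2 * δ * ‖u‖ ≤ 2 * δ * (4 / c₁ * τ) := by gcongr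
    have h2 : (c₂ - δ * (1 + 8 / c₁)) * τ ≤ 0 := by
      have : δ * (1 + 8 / c₁) * τ = δ * τ + 2 * δ * (4 / c₁ * τ) := by ring
      linarith
    nlinarith
  have hu0 : u = 0 := by
    have : ‖u‖ ≤ 0 := by simpa [hτz] using hub'
    simpa using this
  constructor
  · intro k
    have := (Finset.sum_eq_zero_iff_of_nonneg (fun k _ => sq_nonneg ‖v k‖)).1 hτz k
      (Finset.mem_univ k)
    have : v k = 0 := by simpa using this
    exact sub_eq_zero.1 this
  · rw [hu0, inner_zero_right] at hzu
    have : (∑ k, ‖inner 𝕜 (b k) z‖ ^ 2 - t) / 2 = 0 := by exact_mod_cast hzu.symm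
    linarith

end Deterministic

/-! ### From quadratic forms to the semidefinite program. -/

section Exactness

variable {𝕜 : Type*} [RCLike 𝕜] {n m : ℕ}

/-- The vector whose conjugate is the `k`-th row of `B`. -/
noncomputable def conjRow {κ : Type*} (B : Matrix κ (Fin n) 𝕜) (k : κ) : EuclideanSpace 𝕜 (Fin n) :=
  WithLp.toLp 2 fun j => star (B k j)

theorem trace_rankOne_mul {κ : Type*} [Fintype κ] (B : Matrix κ (Fin n) 𝕜)
    (x : EuclideanSpace 𝕜 (Fin n)) :
    (rankOne x * (B.conjTranspose * B)).trace
      = ((∑ k, ‖inner 𝕜 (conjRow B k) x‖ ^ 2 : ℝ) : 𝕜) := by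
  have h1 : ∀ k, inner 𝕜 (conjRow B k) x = (B.mulVec x.ofLp) k := fun k => by
    simp [conjRow, PiLp.inner_apply, Matrix.mulVec, dotProduct, mul_comm]
  have h2 : (rankOne x * (B.conjTranspose * B)).trace
      = dotProduct (star (B.mulVec x.ofLp)) (B.mulVec x.ofLp) := by
    rw [rankOne, Matrix.vecMulVec_mul, Matrix.trace_vecMulVec, ← Matrix.vecMul_vecMul,
      Matrix.star_mulVec, dotProduct_comm, ← Matrix.dotProduct_mulVec]
  rw [h2, dotProduct, RCLike.ofReal_sum]
  refine Finset.sum_congr rfl fun k _ => ?_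
  rw [h1, Pi.star_apply, RCLike.star_def, RCLike.conj_mul]
  norm_cast

theorem rankOne_eq_conjTranspose_mul (x : EuclideanSpace 𝕜 (Fin n)) :
    rankOne x = (Matrix.of fun (_ : Unit) j => star (x j)).conjTranspose
      * (Matrix.of fun (_ : Unit) j => star (x j)) := by
  ext i j
  simp [rankOne, Matrix.vecMulVec, Matrix.mul_apply]

theorem rankOne_mem_feasibleSet (a : Fin m → EuclideanSpace 𝕜 (Fin n))
    (x : EuclideanSpace 𝕜 (Fin n)) : rankOne x ∈ feasibleSet a (measurements a x) := by
  refine ⟨?_, fun i => ?_⟩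
  · rw [rankOne_eq_conjTranspose_mul]
    exact Matrix.posSemidef_conjTranspose_mul_self _
  · rw [rankOne_eq_conjTranspose_mul x, trace_rankOne_mul]
    have : conjRow (Matrix.of fun (_ : Unit) j => star (x j)) () = x := by
      ext j; simp [conjRow]
    rw [Fintype.sum_unique]
    change ((‖inner 𝕜 (conjRow (Matrix.of fun (_ : Unit) j => star (x j)) ()) (a i)‖ ^ 2 : ℝ) : 𝕜)
      = _
    rw [this, measurements, norm_inner_symm (𝕜 := 𝕜) (a i)]

theorem isExact_of_feasibleSet_subset {a : Fin m → EuclideanSpace 𝕜 (Fin n)}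
    {x : EuclideanSpace 𝕜 (Fin n)}
    (h : ∀ X ∈ feasibleSet a (measurements a x), X = rankOne x) : IsExact a x := by
  refine fun X => ⟨fun hX => h X hX.1, ?_⟩
  rintro rfl
  exact ⟨rankOne_mem_feasibleSet a x, fun Z hZ => by
    rw [h Z hZ]; exact le_refl (RCLike.re (rankOne x).trace)⟩

theorem IsRegular.isExact {a : Fin m → EuclideanSpace 𝕜 (Fin n)}
    {w : EuclideanSpace 𝕜 (Fin n) → Fin m → ℝ} {c₁ c₂ δ : ℝ}
    (h : IsRegular (𝕜 := 𝕜) a w c₁ c₂ δ) (hm : 0 < m) (hc₁ : 0 < c₁)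
    (hδ : 0 ≤ δ) (hc₂ : δ * (1 + 8 / c₁) < c₂) (x : EuclideanSpace 𝕜 (Fin n)) : IsExact a x := by
  refine isExact_of_feasibleSet_subset fun X hX => ?_
  obtain ⟨B, rfl⟩ : ∃ B : Matrix (Fin n) (Fin n) 𝕜, X = B.conjTranspose * B := by
    have := hX.1
    open scoped MatrixOrder in
    exact (CStarAlgebra.nonneg_iff_eq_star_mul_self).1 this.nonneg
  have hB : ∀ i, ∑ k, ‖inner 𝕜 (conjRow B k) (a i)‖ ^ 2 = ‖inner 𝕜 x (a i)‖ ^ 2 := fun i => by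
    have := hX.2 i
    rw [trace_rankOne_mul] at this
    rw [norm_inner_symm (𝕜 := 𝕜) x]
    exact_mod_cast this
  have hent : ∀ i j, (B.conjTranspose * B) i j
      = ∑ k, conjRow B k i * star (conjRow B k j) := fun i j => by
    simp [Matrix.mul_apply, conjRow]
  rcases eq_or_ne x 0 with rfl | hx
  · have h0 : ∀ k, conjRow B k = 0 := fun k => h.eq_zero hm hc₁ fun i => by
      have := hB i
      simp only [inner_zero_left, norm_zero, ne_eq, OfNat.ofNat_ne_zero, not_false_eq_true,
        zero_pow] at this
      have := (Finset.sum_eq_zero_iff_of_nonneg (fun k _ => sq_nonneg _)).1 this k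
        (Finset.mem_univ k)
      simpa using this
    ext i j
    rw [hent]
    simp [h0, rankOne, Matrix.vecMulVec]
  · have hn : ‖x‖ ≠ 0 := norm_ne_zero_iff.2 hx
    set z : EuclideanSpace 𝕜 (Fin n) := ((‖x‖⁻¹ : ℝ) : 𝕜) • x with hz
    have hz1 : ‖z‖ = 1 := by
      rw [hz, norm_smul]; simp [hn]
    have hxz : x = ((‖x‖ : ℝ) : 𝕜) • z := by
      rw [hz, smul_smul, ← RCLike.ofReal_mul, mul_inv_cancel₀ hn]; simp
    obtain ⟨h1, h2⟩ := h.eq_smul hm hc₁ hδ hc₂ hz1 (b := conjRow B) (t := ‖x‖ ^ 2) fun i => by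
      rw [hB i]
      conv_lhs => rw [hxz, inner_smul_left, norm_mul]
      simp [mul_pow]
    ext i j
    have h3 : ∀ k, conjRow B k i * star (conjRow B k j)
        = ((‖inner 𝕜 (conjRow B k) z‖ ^ 2 : ℝ) : 𝕜) * (z i * star (z j)) := fun k => by
      have hi : conjRow B k i = inner 𝕜 z (conjRow B k) * z i := by
        conv_lhs => rw [h1 k]
        simp
      have hj : conjRow B k j = inner 𝕜 z (conjRow B k) * z j := by
        conv_lhs => rw [h1 k]
        simp
      rw [hi, hj, norm_inner_symm (𝕜 := 𝕜), RCLike.ofReal_pow, ← RCLike.mul_conj]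
      simp only [star_mul', RCLike.star_def]
      ring
    rw [hent, Finset.sum_congr rfl fun k _ => h3 k, ← Finset.sum_mul, ← RCLike.ofReal_sum, h2]
    have : ∀ i, x i = ((‖x‖ : ℝ) : 𝕜) * z i := fun i => by
      conv_lhs => rw [hxz]
      rw [PiLp.smul_apply, smul_eq_mul]
    simp only [rankOne, Matrix.vecMulVec, Matrix.of_apply, Pi.star_apply]
    rw [this i, this j]
    simp
    ring

/-- Rescaling a_i by r_i multiplies both sides of the i-th constraint by r_i² ≠ 0, so the feasible
set is unchanged. This is what lets spherical vectors be replaced by Gaussian ones. -/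
theorem IsExact.of_smul {a : Fin m → EuclideanSpace 𝕜 (Fin n)} {r : Fin m → ℝ}
    (hr : ∀ i, r i ≠ 0) {x : EuclideanSpace 𝕜 (Fin n)}
    (h : IsExact (fun i => ((r i : ℝ) : 𝕜) • a i) x) : IsExact a x := by
  have hf : feasibleSet (fun i => ((r i : ℝ) : 𝕜) • a i)
      (measurements (fun i => ((r i : ℝ) : 𝕜) • a i) x) = feasibleSet a (measurements a x) := by
    ext X
    refine and_congr_right fun _ => forall_congr' fun i => ?_
    have h1 : rankOne (((r i : ℝ) : 𝕜) • a i) = (((r i) ^ 2 : ℝ) : 𝕜) • rankOne (a i) := by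
      ext k l
      simp only [rankOne, Matrix.vecMulVec, Matrix.smul_apply, Matrix.of_apply, Pi.star_apply,
        PiLp.smul_apply, smul_eq_mul, star_mul', RCLike.star_def, RCLike.conj_ofReal,
        RCLike.ofReal_pow]
      ring
    have h2 : measurements (fun i => ((r i : ℝ) : 𝕜) • a i) x i
        = (r i) ^ 2 * measurements a x i := by
      simp only [measurements, inner_smul_left, norm_mul, mul_pow, RCLike.conj_ofReal,
        RCLike.norm_ofReal, sq_abs]
    rw [h1, h2, Matrix.smul_mul, Matrix.trace_smul, smul_eq_mul, RCLike.ofReal_mul,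
      mul_right_inj']
    exact_mod_cast pow_ne_zero 2 (hr i)
  intro X
  rw [← h X, IsSolution, IsSolution, hf]

end Exactness

/-! ### Nets in finite-dimensional spaces. -/

section Net

open Metric Module
open scoped ENNReal Function

variable {F : Type*} [NormedAddCommGroup F] [NormedSpace ℝ F] [FiniteDimensional ℝ F]

/-- Volumetric bound on the size of an `ε`-separated subset of the unit ball. -/
theorem card_le_of_separated {ε : ℝ} (hε : 0 < ε) (s : Finset F) (hs : ∀ c ∈ s, ‖c‖ ≤ 1)
    (h : ∀ c ∈ s, ∀ d ∈ s, c ≠ d → ε ≤ ‖c - d‖) : (s.card : ℝ) ≤ (1 + 2 / ε) ^ finrank ℝ F := by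
  borelize F
  let μ : Measure F := Measure.addHaar
  let δ : ℝ := ε / 2
  let ρ : ℝ := 1 + ε / 2
  have δpos : 0 < δ := by positivity
  have ρpos : 0 < ρ := by positivity
  set A := ⋃ c ∈ s, ball (c : F) δ with hA
  have D : Set.Pairwise (s : Set F) (Disjoint on fun c => ball (c : F) δ) := by
    rintro c hc d hd hcd
    apply ball_disjoint_ball
    rw [dist_eq_norm]
    have := h c hc d hd hcd
    simp only [δ]
    linarith
  have A_subset : A ⊆ ball (0 : F) ρ := by
    refine Set.iUnion₂_subset fun x hx => ?_
    apply ball_subset_ball'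
    rw [dist_zero_right]
    have := hs x hx
    simp only [δ, ρ]
    linarith
  have I :
    (s.card : ℝ≥0∞) * ENNReal.ofReal (δ ^ finrank ℝ F) * μ (ball 0 1) ≤
      ENNReal.ofReal (ρ ^ finrank ℝ F) * μ (ball 0 1) :=
    calc
      (s.card : ℝ≥0∞) * ENNReal.ofReal (δ ^ finrank ℝ F) * μ (ball 0 1) = μ A := by
        rw [hA, measure_biUnion_finset D fun c _ => measurableSet_ball]
        simp only [μ.addHaar_ball_of_pos _ δpos]
        simp only [Finset.sum_const, nsmul_eq_mul, mul_assoc]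
      _ ≤ μ (ball (0 : F) ρ) := measure_mono A_subset
      _ = ENNReal.ofReal (ρ ^ finrank ℝ F) * μ (ball 0 1) := by
        simp only [μ.addHaar_ball_of_pos _ ρpos]
  have J : (s.card : ℝ≥0∞) * ENNReal.ofReal (δ ^ finrank ℝ F) ≤ ENNReal.ofReal (ρ ^ finrank ℝ F) :=
    (ENNReal.mul_le_mul_iff_left (measure_ball_pos _ _ zero_lt_one).ne' measure_ball_lt_top.ne).1 I
  have K := ENNReal.toReal_le_of_le_ofReal (pow_nonneg ρpos.le _) J
  rw [ENNReal.toReal_mul, ENNReal.toReal_natCast,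
    ENNReal.toReal_ofReal (pow_nonneg δpos.le _)] at K
  have : 1 + 2 / ε = ρ / δ := by simp only [ρ, δ]; field_simp; ring
  rw [this, div_pow, le_div_iff₀ (pow_pos δpos _)]
  exact K

/-- Every subset of the unit ball has an internal `ε`-net of cardinality at most
`(1 + 2 / ε) ^ dim`. -/
theorem exists_net {ε : ℝ} (hε : 0 < ε) (T : Set F) (hT : ∀ x ∈ T, ‖x‖ ≤ 1) :
    ∃ N : Finset F, (∀ x ∈ N, x ∈ T) ∧ (N.card : ℝ) ≤ (1 + 2 / ε) ^ finrank ℝ F ∧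
      ∀ x ∈ T, ∃ y ∈ N, ‖x - y‖ ≤ ε := by
  classical
  by_contra! hcon
  have hk : ∀ k : ℕ, ∃ s : Finset F, s.card = k ∧ (∀ x ∈ s, x ∈ T) ∧
      ∀ c ∈ s, ∀ d ∈ s, c ≠ d → ε ≤ ‖c - d‖ := by
    intro k
    induction k with
    | zero => exact ⟨∅, by simp⟩
    | succ k ih =>
      obtain ⟨s, hs, hsT, hsep⟩ := ih
      obtain ⟨x, hxT, hx⟩ := hcon s hsT
        (card_le_of_separated hε s (fun c hc => hT c (hsT c hc)) hsep)
      have hxs : x ∉ s := fun hmem => by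
        have := hx x hmem
        rw [sub_self, norm_zero] at this
        linarith
      refine ⟨insert x s, by rw [Finset.card_insert_of_notMem hxs, hs], ?_, ?_⟩
      · intro y hy
        rcases Finset.mem_insert.1 hy with rfl | hy
        exacts [hxT, hsT y hy]
      · intro c hc d hd hcd
        rcases Finset.mem_insert.1 hc with rfl | hc' <;>
          rcases Finset.mem_insert.1 hd with rfl | hd'
        · exact absurd rfl hcd
        · exact (hx d hd').le
        · rw [norm_sub_rev]; exact (hx c hc').le
        · exact hsep c hc' d hd' hcd
  obtain ⟨k, hk'⟩ := exists_nat_gt ((1 + 2 / ε) ^ finrank ℝ F)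
  obtain ⟨s, hs, hsT, hsep⟩ := hk k
  have := card_le_of_separated hε s (fun c hc => hT c (hsT c hc)) hsep
  rw [hs] at this
  linarith

end Net

/-! ### Chernoff bounds from an exponential moment. -/

section Chernoff

open Real

theorem exp_le_one_add_add_sq_mul (y : ℝ) : exp y ≤ 1 + y + y ^ 2 * exp |y| := by
  rcases le_or_gt |y| 1 with hy | hy
  · have h1 := (abs_le.1 (Real.abs_exp_sub_one_sub_id_le hy)).2
    have h2 : 1 ≤ exp |y| := one_le_exp (abs_nonneg y)
    nlinarith [sq_nonneg y]
  · rcases le_or_gt 0 y with h0 | h0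
    · rw [abs_of_nonneg h0] at hy ⊢
      have : 1 ≤ y ^ 2 := by nlinarith
      nlinarith [exp_pos y]
    · rw [abs_of_neg h0] at hy ⊢
      have h1 : exp y ≤ 1 := exp_le_one_iff.2 h0.le
      have h2 : 1 ≤ exp (-y) := one_le_exp (by linarith)
      nlinarith

/-- Half of the exponent s absorbs exp |rx|, the other half absorbs x² through y²/2 ≤ exp y at y =
s|x|/2. The remainder in the moment generating function is thereby bounded by r² times the available
moment. -/
theorem sq_mul_exp_le {s r x : ℝ} (hs : 0 < s) (hr : 0 ≤ r) (hrs : r ≤ s / 2) :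
    (r * x) ^ 2 * exp |r * x| ≤ 8 / s ^ 2 * r ^ 2 * exp (s * |x|) := by
  have h1 : exp |r * x| ≤ exp (s / 2 * |x|) := by
    rw [abs_mul, abs_of_nonneg hr]
    exact exp_le_exp.2 (mul_le_mul_of_nonneg_right hrs (abs_nonneg x))
  have h2 : (s / 2 * |x|) ^ 2 / 2 ≤ exp (s / 2 * |x|) := by
    have := quadratic_le_exp_of_nonneg (x := s / 2 * |x|) (by positivity)
    have : 0 ≤ s / 2 * |x| := by positivity
    linarith
  have h3 : x ^ 2 ≤ 8 / s ^ 2 * exp (s / 2 * |x|) := by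
    have : x ^ 2 = 8 / s ^ 2 * ((s / 2 * |x|) ^ 2 / 2) := by
      rw [mul_pow, sq_abs]; field_simp; norm_num
    rw [this]
    gcongr
  calc (r * x) ^ 2 * exp |r * x| = r ^ 2 * (x ^ 2 * exp |r * x|) := by ring
    _ ≤ r ^ 2 * (8 / s ^ 2 * exp (s / 2 * |x|) * exp (s / 2 * |x|)) := by gcongr
    _ = 8 / s ^ 2 * r ^ 2 * exp (s * |x|) := by
      rw [mul_assoc (8 / s ^ 2), ← exp_add]; ring_nf

/-- The exponent in the Chernoff bound for variables with `𝔼 exp (s |f|) ≤ M` and deviation `δ`. -/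
noncomputable def chernoffRate (s M δ : ℝ) : ℝ :=
  min (s / 2) (δ / (2 * (8 / s ^ 2 * M))) * δ / 2

theorem chernoffRate_pos {s M δ : ℝ} (hs : 0 < s) (hM : 0 < M) (hδ : 0 < δ) :
    0 < chernoffRate s M δ := by
  unfold chernoffRate
  have : 0 < min (s / 2) (δ / (2 * (8 / s ^ 2 * M))) := lt_min (by positivity) (by positivity)
  positivity

variable {E : Type*} [MeasurableSpace E] {μ : Measure E}

theorem integrable_of_integrable_exp {f : E → ℝ} (hf : Measurable f) {s : ℝ} (hs : 0 < s)
    (hint : Integrable (fun x => exp (s * |f x|)) μ) : Integrable f μ := by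
  refine (hint.const_mul s⁻¹).mono' hf.aestronglyMeasurable (ae_of_all _ fun x => ?_)
  have := add_one_le_exp (s * |f x|)
  rw [norm_eq_abs, inv_mul_eq_div, le_div_iff₀ hs]
  linarith

variable [IsProbabilityMeasure μ]

theorem measureReal_pi_sum_ge_le {f : E → ℝ} (hf : Measurable f) {s M δ : ℝ} (hs : 0 < s)
    (hM : 0 < M) (hδ : 0 < δ) (hint : Integrable (fun x => exp (s * |f x|)) μ)
    (hle : ∫ x, exp (s * |f x|) ∂μ ≤ M) (m : ℕ) :
    (Measure.pi fun _ : Fin m => μ).real {a | m * (∫ x, f x ∂μ + δ) ≤ ∑ i, f (a i)}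
      ≤ exp (-chernoffRate s M δ * m) := by
  -- The Chernoff parameter: at most s/2 so that the moment applies, and small enough that the
  -- second-order term (8/s²)r²M costs at most half of the gain rδ.
  set r : ℝ := min (s / 2) (δ / (2 * (8 / s ^ 2 * M))) with hr
  have hrpos : 0 < r := lt_min (by positivity) (by positivity)
  have hrs : r ≤ s / 2 := min_le_left _ _
  have hint1 : Integrable (fun x => exp (r * f x)) μ := by
    refine hint.mono' (by fun_prop) (ae_of_all _ fun x => ?_)
    rw [norm_eq_abs, abs_of_pos (exp_pos _), exp_le_exp]
    calc r * f x ≤ r * |f x| := mul_le_mul_of_nonneg_left (le_abs_self _) hrpos.le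
      _ ≤ s * |f x| := mul_le_mul_of_nonneg_right (by linarith) (abs_nonneg _)
  have hfi := integrable_of_integrable_exp hf hs hint
  have hmgf : ∫ x, exp (r * f x) ∂μ ≤ exp (r * ∫ x, f x ∂μ + 8 / s ^ 2 * r ^ 2 * M) := by
    calc ∫ x, exp (r * f x) ∂μ
        ≤ ∫ x, ((1 + r * f x) + 8 / s ^ 2 * r ^ 2 * exp (s * |f x|)) ∂μ := by
          refine integral_mono hint1 ?_ fun x => ?_
          · exact ((integrable_const 1).add (hfi.const_mul r)).add (hint.const_mul _)
          · exact (exp_le_one_add_add_sq_mul _).trans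
              (add_le_add_right (sq_mul_exp_le hs hrpos.le hrs) _)
      _ = 1 + r * ∫ x, f x ∂μ + 8 / s ^ 2 * r ^ 2 * ∫ x, exp (s * |f x|) ∂μ := by
          rw [integral_add (f := fun x => 1 + r * f x)
            ((integrable_const 1).add (hfi.const_mul r)) (hint.const_mul _),
            integral_add (integrable_const 1) (hfi.const_mul r), integral_const_mul,
            integral_const_mul]
          simp
      _ ≤ 1 + r * ∫ x, f x ∂μ + 8 / s ^ 2 * r ^ 2 * M := by gcongr
      _ ≤ _ := by
          have := add_one_le_exp (r * ∫ x, f x ∂μ + 8 / s ^ 2 * r ^ 2 * M)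
          linarith
  have hprod : ∀ a : Fin m → E, exp (r * ∑ i, f (a i)) = ∏ i, exp (r * f (a i)) := fun a => by
    rw [Finset.mul_sum, exp_sum]
  have hch := measure_ge_le_exp_mul_mgf (μ := Measure.pi fun _ : Fin m => μ)
    (X := fun a => ∑ i, f (a i)) (t := r) (m * (∫ x, f x ∂μ + δ)) hrpos.le (by
      simp_rw [hprod]
      exact Integrable.fintype_prod (f := fun _ x => exp (r * f x)) fun _ => hint1)
  have hmg : mgf (fun a : Fin m → E => ∑ i, f (a i)) (Measure.pi fun _ : Fin m => μ) r
      = (∫ x, exp (r * f x) ∂μ) ^ m := by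
    rw [mgf]
    simp_rw [hprod]
    rw [integral_fintype_prod_eq_prod (f := fun _ x => exp (r * f x))]
    simp
  refine hch.trans ?_
  rw [hmg]
  calc exp (-r * (m * (∫ x, f x ∂μ + δ))) * (∫ x, exp (r * f x) ∂μ) ^ m
      ≤ exp (-r * (m * (∫ x, f x ∂μ + δ)))
        * exp (r * ∫ x, f x ∂μ + 8 / s ^ 2 * r ^ 2 * M) ^ m := by
        gcongr
    _ = exp (m * (8 / s ^ 2 * r ^ 2 * M - r * δ)) := by
        rw [← exp_nat_mul, ← exp_add]; ring_nf
    _ ≤ exp (-chernoffRate s M δ * m) := by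
        rw [exp_le_exp, chernoffRate, ← hr]
        have h1 : r ≤ δ / (2 * (8 / s ^ 2 * M)) := min_le_right _ _
        have h2 : 8 / s ^ 2 * M * r ≤ δ / 2 := by
          rw [le_div_iff₀ (by positivity)] at h1
          linarith
        have h3 : 8 / s ^ 2 * r ^ 2 * M ≤ r * δ / 2 := by nlinarith
        have : (0 : ℝ) ≤ m := m.cast_nonneg
        nlinarith

/-- Chernoff bound for empirical means of a variable with an exponential moment. -/
theorem measureReal_pi_abs_sum_sub_ge_le {f : E → ℝ} (hf : Measurable f) {s M δ : ℝ} (hs : 0 < s)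
    (hM : 0 < M) (hδ : 0 < δ) (hint : Integrable (fun x => exp (s * |f x|)) μ)
    (hle : ∫ x, exp (s * |f x|) ∂μ ≤ M) (m : ℕ) :
    (Measure.pi fun _ : Fin m => μ).real {a | m * δ ≤ |∑ i, f (a i) - m * ∫ x, f x ∂μ|}
      ≤ 2 * exp (-chernoffRate s M δ * m) := by
  have h1 := measureReal_pi_sum_ge_le hf hs hM hδ hint hle m
  have h2 := measureReal_pi_sum_ge_le (f := fun x => -f x) hf.neg hs hM hδ
    (by simpa using hint) (by simpa using hle) m
  have hsub : {a : Fin m → E | m * δ ≤ |∑ i, f (a i) - m * ∫ x, f x ∂μ|}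
      ⊆ {a | m * (∫ x, f x ∂μ + δ) ≤ ∑ i, f (a i)}
        ∪ {a | m * (∫ x, -f x ∂μ + δ) ≤ ∑ i, -f (a i)} := by
    intro a ha
    simp only [Set.mem_ofPred_eq, Set.mem_union] at ha ⊢
    rw [integral_neg, Finset.sum_neg_distrib]
    rcases le_abs.1 ha with h | h
    · left; linarith
    · right; linarith
  calc _ ≤ _ := measureReal_mono hsub
    _ ≤ _ := measureReal_union_le _ _
    _ ≤ _ := by linarith

/-- Simultaneous concentration of finitely many empirical means. -/
theorem exists_measurableSet_concentration {ι : Type*} (N : Finset ι) {f : ι → E → ℝ}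
    (hf : ∀ k ∈ N, Measurable (f k))
    {s M δ : ℝ} (hs : 0 < s) (hM : 0 < M) (hδ : 0 < δ)
    (hint : ∀ k ∈ N, Integrable (fun x => exp (s * |f k x|)) μ)
    (hle : ∀ k ∈ N, ∫ x, exp (s * |f k x|) ∂μ ≤ M) (m : ℕ) :
    ∃ G : Set (Fin m → E), MeasurableSet G ∧
      (Measure.pi fun _ : Fin m => μ).real Gᶜ ≤ N.card * (2 * exp (-chernoffRate s M δ * m)) ∧
      ∀ a ∈ G, ∀ k ∈ N, |∑ i, f k (a i) - m * ∫ x, f k x ∂μ| ≤ m * δ := by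
  refine ⟨⋂ k ∈ N, {a | |∑ i, f k (a i) - m * ∫ x, f k x ∂μ| < m * δ}, ?_, ?_, ?_⟩
  · refine Finset.measurableSet_biInter _ fun k hk => measurableSet_lt ?_ measurable_const
    have := hf k hk
    fun_prop
  · rw [Set.compl_iInter₂]
    refine (measureReal_biUnion_finset_le N _).trans ?_
    refine (Finset.sum_le_card_nsmul N _ (2 * exp (-chernoffRate s M δ * m))
      fun k hk => ?_).trans_eq (nsmul_eq_mul _ _)
    have hset : {a : Fin m → E | |∑ i, f k (a i) - m * ∫ x, f k x ∂μ| < m * δ}ᶜ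
        = {a | m * δ ≤ |∑ i, f k (a i) - m * ∫ x, f k x ∂μ|} := by
      ext a; simp
    rw [hset]
    exact measureReal_pi_abs_sum_sub_ge_le (hf k hk) hs hM hδ (hint k hk) (hle k hk) m
  · intro a ha k hk
    exact le_of_lt (Set.mem_iInter₂.1 ha k hk)

end Chernoff

/-! ### Moments of one scalar coordinate and of an independent pair. -/

section Moments

theorem abs_re_mul_star_le {𝕜 : Type*} [RCLike 𝕜] (x y : 𝕜) :
    |RCLike.re (y * star x)| ≤ ‖x‖ ^ 2 + ‖y‖ ^ 2 := by
  refine (RCLike.abs_re_le_norm _).trans ?_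
  rw [norm_mul, norm_star]
  nlinarith [sq_nonneg (‖x‖ - ‖y‖), sq_nonneg ‖x‖, sq_nonneg ‖y‖]

variable {𝕜 : Type*} [RCLike 𝕜] [MeasurableSpace 𝕜] [BorelSpace 𝕜]

/-- A symmetric probability distribution on the scalars with unit second moment, full support and
a square-exponential moment. -/
structure IsScalarModel (ν : Measure 𝕜) (s : ℝ) : Prop where
  isProbabilityMeasure : IsProbabilityMeasure ν
  isOpenPosMeasure : ν.IsOpenPosMeasure
  map_neg : ν.map (fun x => -x) = ν
  integral_norm_sq : ∫ x, ‖x‖ ^ 2 ∂ν = 1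
  pos : 0 < s
  integrable_exp : Integrable (fun x => Real.exp (s * ‖x‖ ^ 2)) ν

variable {ν : Measure 𝕜} {s : ℝ}

theorem IsScalarModel.integrable_norm_sq (h : IsScalarModel ν s) :
    Integrable (fun x => ‖x‖ ^ 2) ν := by
  refine integrable_of_integrable_exp (by fun_prop) h.pos ?_
  simpa using h.integrable_exp

theorem IsScalarModel.integrable_norm_pow_four (h : IsScalarModel ν s) :
    Integrable (fun x => ‖x‖ ^ 4) ν := by
  refine (h.integrable_exp.const_mul (2 / s ^ 2)).mono' (by fun_prop) (ae_of_all _ fun x => ?_)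
  have h0 := h.pos
  have h1 := Real.quadratic_le_exp_of_nonneg (x := s * ‖x‖ ^ 2) (by positivity)
  have h2 : 0 ≤ s * ‖x‖ ^ 2 := by positivity
  rw [Real.norm_eq_abs, abs_of_nonneg (by positivity), div_mul_eq_mul_div,
    le_div_iff₀ (by positivity)]
  nlinarith

/-- The truncated second moment that centers the certificate weights. -/
noncomputable def certShift (ν : Measure 𝕜) : ℝ := ∫ x, min (‖x‖ ^ 2) 1 * ‖x‖ ^ 2 ∂ν

/-- The mean of the certificate weights. -/
noncomputable def certGap (ν : Measure 𝕜) : ℝ := ∫ x, (certShift ν - min (‖x‖ ^ 2) 1) ∂ν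

/-- The mean of `|re (η ξ̄)|` for independent `ξ`, `η`. -/
noncomputable def crossMoment (ν : Measure 𝕜) : ℝ :=
  ∫ p, |RCLike.re (p.2 * star p.1)| ∂(ν.prod ν)

theorem integrable_min_norm_sq [IsFiniteMeasure ν] :
    Integrable (fun x => min (‖x‖ ^ 2) 1) ν := by
  refine (integrable_const (1 : ℝ)).mono' (by fun_prop) (ae_of_all _ fun x => ?_)
  rw [Real.norm_eq_abs, abs_of_nonneg (by positivity)]
  exact min_le_right _ _

theorem IsScalarModel.integrable_min_mul (h : IsScalarModel ν s) :
    Integrable (fun x => min (‖x‖ ^ 2) 1 * ‖x‖ ^ 2) ν := by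
  refine h.integrable_norm_sq.mono' (by fun_prop) (ae_of_all _ fun x => ?_)
  rw [Real.norm_eq_abs, abs_of_nonneg (by positivity)]
  exact mul_le_of_le_one_left (by positivity) (min_le_right _ _)

theorem IsScalarModel.certShift_mem (h : IsScalarModel ν s) :
    0 ≤ certShift ν ∧ certShift ν ≤ 1 := by
  refine ⟨integral_nonneg fun x => by positivity, ?_⟩
  rw [← h.integral_norm_sq]
  refine integral_mono h.integrable_min_mul h.integrable_norm_sq fun x => ?_
  exact mul_le_of_le_one_left (by positivity) (min_le_right _ _)

theorem IsScalarModel.integral_weight_mul (h : IsScalarModel ν s) :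
    ∫ x, (certShift ν - min (‖x‖ ^ 2) 1) * ‖x‖ ^ 2 ∂ν = 0 := by
  simp_rw [sub_mul]
  rw [integral_sub (h.integrable_norm_sq.const_mul _) h.integrable_min_mul, integral_const_mul,
    h.integral_norm_sq, certShift]
  ring

/-- Because ‖x‖² has mean 1, the gap is the mean of (min(‖x‖², 1) - 1)(‖x‖² - 1), that is, the
covariance of ‖x‖² with its truncation. The integrand is nonnegative, continuous and nonzero at 0,
and ν has full support. -/
theorem IsScalarModel.certGap_pos (h : IsScalarModel ν s) : 0 < certGap ν := by
  have := h.isProbabilityMeasure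
  have := h.isOpenPosMeasure
  have hi1 := integrable_min_norm_sq (ν := ν)
  have hgap : certGap ν = ∫ x, (min (‖x‖ ^ 2) 1 - 1) * (‖x‖ ^ 2 - 1) ∂ν := by
    have h1 : ∀ x : 𝕜, (min (‖x‖ ^ 2) 1 - 1) * (‖x‖ ^ 2 - 1)
        = (min (‖x‖ ^ 2) 1 * ‖x‖ ^ 2 - min (‖x‖ ^ 2) 1) - (‖x‖ ^ 2 - 1) := fun x => by ring
    simp_rw [h1]
    rw [integral_sub (f := fun x => min (‖x‖ ^ 2) 1 * ‖x‖ ^ 2 - min (‖x‖ ^ 2) 1)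
        (g := fun x => ‖x‖ ^ 2 - 1) (h.integrable_min_mul.sub hi1)
        (h.integrable_norm_sq.sub (integrable_const 1)),
      integral_sub h.integrable_min_mul hi1, integral_sub h.integrable_norm_sq (integrable_const 1),
      h.integral_norm_sq, certGap, integral_sub (integrable_const _) hi1, certShift]
    simp
  rw [hgap]
  refine integral_pos_of_integrable_nonneg_nonzero (x := 0) (by fun_prop) ?_ ?_ ?_
  · have h1 : ∀ x : 𝕜, (min (‖x‖ ^ 2) 1 - 1) * (‖x‖ ^ 2 - 1)
        = (min (‖x‖ ^ 2) 1 * ‖x‖ ^ 2 - min (‖x‖ ^ 2) 1) - (‖x‖ ^ 2 - 1) := fun x => by ring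
    simp_rw [h1]
    exact (h.integrable_min_mul.sub hi1).sub (h.integrable_norm_sq.sub (integrable_const 1))
  · intro x
    rcases le_total (‖x‖ ^ 2) 1 with hx | hx
    · simp only [min_eq_left hx, Pi.zero_apply]; nlinarith
    · simp [min_eq_right hx]
  · simp

theorem IsScalarModel.certGap_le (h : IsScalarModel ν s) : certGap ν ≤ 1 := by
  have := h.isProbabilityMeasure
  rw [certGap, integral_sub (integrable_const _) integrable_min_norm_sq]
  have : 0 ≤ ∫ x, min (‖x‖ ^ 2) 1 ∂ν := integral_nonneg fun x => by positivity
  have := h.certShift_mem.2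
  simp
  linarith

theorem IsScalarModel.integrable_prod_norm_sq (h : IsScalarModel ν s) :
    Integrable (fun p : 𝕜 × 𝕜 => ‖p.1‖ ^ 2 + ‖p.2‖ ^ 2) (ν.prod ν) := by
  have := h.isProbabilityMeasure
  exact (h.integrable_norm_sq.comp_fst ν).add (h.integrable_norm_sq.comp_snd ν)

theorem measurable_abs_re_mul_star :
    Measurable (fun p : 𝕜 × 𝕜 => |RCLike.re (p.2 * star p.1)|) := by
  have : Continuous (fun p : 𝕜 × 𝕜 => |RCLike.re (p.2 * star p.1)|) :=
    (RCLike.continuous_re.comp (continuous_snd.mul continuous_fst.star)).abs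
  exact this.measurable

theorem IsScalarModel.integrable_cross (h : IsScalarModel ν s) :
    Integrable (fun p : 𝕜 × 𝕜 => |RCLike.re (p.2 * star p.1)|) (ν.prod ν) := by
  refine h.integrable_prod_norm_sq.mono' measurable_abs_re_mul_star.aestronglyMeasurable
    (ae_of_all _ fun p => ?_)
  rw [Real.norm_eq_abs, abs_abs]
  exact abs_re_mul_star_le _ _

theorem IsScalarModel.crossMoment_pos (h : IsScalarModel ν s) : 0 < crossMoment ν := by
  have := h.isProbabilityMeasure
  have := h.isOpenPosMeasure
  refine integral_pos_of_integrable_nonneg_nonzero (x := (1, 1)) ?_ h.integrable_cross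
    (fun p => abs_nonneg _) (by simp)
  exact (RCLike.continuous_re.comp (continuous_snd.mul continuous_fst.star)).abs

/-- Pointwise, the excess of t = ‖x‖² over K is at most t²/K. -/
theorem IsScalarModel.integral_tail_le (h : IsScalarModel ν s) {K : ℝ} (hK : 0 < K) :
    ∫ x, max (‖x‖ ^ 2 - K) 0 ∂ν ≤ (∫ x, ‖x‖ ^ 4 ∂ν) / K := by
  rw [div_eq_inv_mul, ← integral_const_mul]
  refine integral_mono_of_nonneg (ae_of_all _ fun x => le_max_right _ _)
    (h.integrable_norm_pow_four.const_mul _) (ae_of_all _ fun x => max_le ?_ (by positivity))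
  change ‖x‖ ^ 2 - K ≤ K⁻¹ * ‖x‖ ^ 4
  rw [inv_mul_eq_div, le_div_iff₀ hK]
  nlinarith [sq_nonneg (‖x‖ ^ 2 - K), sq_nonneg (‖x‖ ^ 2)]

/-- Integrals against `ν ⊗ ν` may be symmetrized in the second variable. -/
theorem IsScalarModel.integral_prod_eq_symm (h : IsScalarModel ν s) {g : 𝕜 × 𝕜 → ℝ}
    (hg : Integrable g (ν.prod ν)) :
    ∫ p, g p ∂(ν.prod ν) = ∫ p, (g p + g (p.1, -p.2)) / 2 ∂(ν.prod ν) ∧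
      Integrable (fun p => (g p + g (p.1, -p.2)) / 2) (ν.prod ν) := by
  have := h.isProbabilityMeasure
  have hmp : MeasurePreserving (Prod.map id fun x : 𝕜 => -x) (ν.prod ν) (ν.prod ν) :=
    (MeasurePreserving.id ν).prod ⟨measurable_neg, h.map_neg⟩
  have hemb : MeasurableEmbedding (Prod.map id fun x : 𝕜 => -x) :=
    (MeasurableEquiv.prodCongr (MeasurableEquiv.refl 𝕜) (MeasurableEquiv.neg 𝕜)).measurableEmbedding
  have h1 : ∫ p, g (p.1, -p.2) ∂(ν.prod ν) = ∫ p, g p ∂(ν.prod ν) := hmp.integral_comp hemb g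
  have h2 : Integrable (fun p => g (p.1, -p.2)) (ν.prod ν) :=
    (hmp.integrable_comp_emb hemb).2 hg
  refine ⟨?_, (hg.add h2).div_const 2⟩
  rw [integral_div, integral_add hg h2, h1]
  ring

end Moments

/-! ### Expectations for isotropic vectors. -/

section Isotropic

/-- The part of `v` orthogonal to the unit vector `z`: either it vanishes, or it is a positive
multiple of a unit vector. -/
theorem exists_orthonormal_decomp {𝕜 E : Type*} [RCLike 𝕜] [NormedAddCommGroup E]
    [InnerProductSpace 𝕜 E] {z v : E} (hz : ‖z‖ = 1) (hv : ‖v‖ = 1) :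
    v = inner 𝕜 z v • z ∧ ‖inner 𝕜 z v‖ = 1 ∨
    ∃ (v' : E) (ρ : ℝ), ‖v'‖ = 1 ∧ inner 𝕜 z v' = 0 ∧ 0 ≤ ρ ∧ ‖inner 𝕜 z v‖ ^ 2 + ρ ^ 2 = 1 ∧
      v = inner 𝕜 z v • z + (ρ : 𝕜) • v' := by
  have zz : inner 𝕜 z z = (1 : 𝕜) := by rw [inner_self_eq_norm_sq_to_K, hz]; simp
  set r := v - inner 𝕜 z v • z with hr
  have hzr : inner 𝕜 z r = 0 := by rw [hr, inner_sub_right, inner_smul_right, zz]; ring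
  have hvr : v = inner 𝕜 z v • z + r := by rw [hr]; abel
  rcases eq_or_ne r 0 with h0 | h0
  · left
    rw [h0, add_zero] at hvr
    refine ⟨hvr, ?_⟩
    have := congrArg norm hvr
    rwa [norm_smul, hz, hv, mul_one, eq_comm] at this
  · right
    have hn : ‖r‖ ≠ 0 := norm_ne_zero_iff.2 h0
    refine ⟨((‖r‖⁻¹ : ℝ) : 𝕜) • r, ‖r‖, ?_, ?_, norm_nonneg _, ?_, ?_⟩
    · rw [norm_smul]; simp [hn]
    · rw [inner_smul_right, hzr, mul_zero]
    · have horth : inner 𝕜 (inner 𝕜 z v • z) r = 0 := by rw [inner_smul_left, hzr, mul_zero]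
      have := norm_add_sq_eq_norm_sq_add_norm_sq_of_inner_eq_zero _ _ horth
      rw [← hvr, norm_smul, hz, hv] at this
      nlinarith
    · rw [smul_smul, ← RCLike.ofReal_mul, mul_inv_cancel₀ hn]
      simpa using hvr

variable {𝕜 E : Type*} [RCLike 𝕜] [MeasurableSpace 𝕜] [BorelSpace 𝕜]
  [NormedAddCommGroup E] [InnerProductSpace 𝕜 E] [MeasurableSpace E] [BorelSpace E]

/-- All coordinates of `μ` in orthonormal directions have law `ν`, and are pairwise independent. -/
structure IsIsotropic (ν : Measure 𝕜) (μ : Measure E) : Prop where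
  map_inner : ∀ v : E, ‖v‖ = 1 → μ.map (fun x => inner 𝕜 x v) = ν
  map_inner_pair : ∀ z v : E, ‖z‖ = 1 → ‖v‖ = 1 → inner 𝕜 z v = 0 →
    μ.map (fun x => (inner 𝕜 x z, inner 𝕜 x v)) = ν.prod ν

variable {ν : Measure 𝕜} {μ : Measure E} {s : ℝ}

theorem measurable_inner_right (v : E) : Measurable (fun x : E => inner 𝕜 x v) :=
  (continuous_id.inner continuous_const).measurable

theorem IsIsotropic.measurePreserving (h : IsIsotropic ν μ) {v : E} (hv : ‖v‖ = 1) :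
    MeasurePreserving (fun x => inner 𝕜 x v) μ ν :=
  ⟨measurable_inner_right v, h.map_inner v hv⟩

theorem IsIsotropic.measurePreserving_pair (h : IsIsotropic ν μ) {z v : E} (hz : ‖z‖ = 1)
    (hv : ‖v‖ = 1) (hzv : inner 𝕜 z v = 0) :
    MeasurePreserving (fun x => (inner 𝕜 x z, inner 𝕜 x v)) μ (ν.prod ν) :=
  ⟨(measurable_inner_right z).prodMk (measurable_inner_right v), h.map_inner_pair z v hz hv hzv⟩

theorem _root_.MeasureTheory.MeasurePreserving.integral_comp_of_measurable {α β : Type*}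
    [MeasurableSpace α] [MeasurableSpace β] {μ : Measure α} {ν : Measure β} {f : α → β}
    (hf : MeasurePreserving f μ ν) {g : β → ℝ} (hg : Measurable g) :
    ∫ x, g (f x) ∂μ = ∫ y, g y ∂ν := by
  rw [← hf.map_eq, integral_map hf.measurable.aemeasurable hg.aestronglyMeasurable]

/-- By the arithmetic-geometric mean inequality, exp((A + B)/2) ≤ (exp A + exp B)/2, which separates
the two coordinates. Orthogonality of z and v is not needed, and one moment bound serves every
function on the nets. -/
theorem IsIsotropic.integrable_exp (h : IsIsotropic ν μ) (hν : IsScalarModel ν s) {f : E → ℝ}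
    (hf : Measurable f) {z v : E} (hz : ‖z‖ = 1) (hv : ‖v‖ = 1)
    (hle : ∀ x, |f x| ≤ ‖inner 𝕜 x z‖ ^ 2 + ‖inner 𝕜 x v‖ ^ 2) :
    Integrable (fun x => Real.exp (s / 2 * |f x|)) μ ∧
      ∫ x, Real.exp (s / 2 * |f x|) ∂μ ≤ ∫ x, Real.exp (s * ‖x‖ ^ 2) ∂ν := by
  have hs := hν.pos
  have hi : ∀ u : E, ‖u‖ = 1 → Integrable (fun x => Real.exp (s * ‖inner 𝕜 x u‖ ^ 2)) μ :=
    fun u hu => (h.measurePreserving hu).integrable_comp_of_integrable hν.integrable_exp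
  have he : ∀ u : E, ‖u‖ = 1 → ∫ x, Real.exp (s * ‖inner 𝕜 x u‖ ^ 2) ∂μ
      = ∫ x, Real.exp (s * ‖x‖ ^ 2) ∂ν := fun u hu =>
    (h.measurePreserving hu).integral_comp_of_measurable
      (g := fun y => Real.exp (s * ‖y‖ ^ 2)) (by fun_prop)
  have hb : ∀ x, Real.exp (s / 2 * |f x|)
      ≤ (Real.exp (s * ‖inner 𝕜 x z‖ ^ 2) + Real.exp (s * ‖inner 𝕜 x v‖ ^ 2)) / 2 := fun x => by
    have h1 : s / 2 * |f x| ≤ s * ‖inner 𝕜 x z‖ ^ 2 / 2 + s * ‖inner 𝕜 x v‖ ^ 2 / 2 := by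
      have := mul_le_mul_of_nonneg_left (hle x) (half_pos hs).le
      linarith
    have h2 : ∀ y : ℝ, Real.exp y = Real.exp (y / 2) * Real.exp (y / 2) := fun y => by
      rw [← Real.exp_add]; ring_nf
    refine (Real.exp_le_exp.2 h1).trans ?_
    rw [Real.exp_add, h2 (s * ‖inner 𝕜 x z‖ ^ 2), h2 (s * ‖inner 𝕜 x v‖ ^ 2)]
    nlinarith [sq_nonneg (Real.exp (s * ‖inner 𝕜 x z‖ ^ 2 / 2)
      - Real.exp (s * ‖inner 𝕜 x v‖ ^ 2 / 2))]
  have hint : Integrable (fun x => Real.exp (s / 2 * |f x|)) μ := by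
    refine (((hi z hz).add (hi v hv)).div_const 2).mono' (by fun_prop) (ae_of_all _ fun x => ?_)
    rw [Real.norm_eq_abs, abs_of_pos (Real.exp_pos _)]
    exact hb x
  refine ⟨hint, ?_⟩
  refine (integral_mono hint (((hi z hz).add (hi v hv)).div_const 2) hb).trans_eq ?_
  rw [integral_div]
  simp only [Pi.add_apply]
  rw [integral_add (hi z hz) (hi v hv), he z hz, he v hv]
  ring

theorem IsIsotropic.integral_norm_inner_sq (h : IsIsotropic ν μ) (hν : IsScalarModel ν s) {v : E}
    (hv : ‖v‖ = 1) : ∫ x, ‖inner 𝕜 x v‖ ^ 2 ∂μ = 1 :=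
  ((h.measurePreserving hv).integral_comp_of_measurable (g := fun y => ‖y‖ ^ 2)
    (by fun_prop)).trans hν.integral_norm_sq

theorem IsIsotropic.integral_tail_le (h : IsIsotropic ν μ) (hν : IsScalarModel ν s) {v : E}
    (hv : ‖v‖ = 1) {K : ℝ} (hK : 0 < K) :
    ∫ x, max (‖inner 𝕜 x v‖ ^ 2 - K) 0 ∂μ ≤ (∫ x, ‖x‖ ^ 4 ∂ν) / K :=
  ((h.measurePreserving hv).integral_comp_of_measurable (g := fun y => max (‖y‖ ^ 2 - K) 0)
    (by fun_prop)).trans_le (hν.integral_tail_le hK)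

theorem abs_weight_le {β : ℝ} (hβ : 0 ≤ β ∧ β ≤ 1) (t : ℝ) (ht : 0 ≤ t) : |β - min t 1| ≤ 1 := by
  have := min_le_right t 1
  have : 0 ≤ min t 1 := le_min ht zero_le_one
  rw [abs_le]
  constructor <;> linarith [hβ.1, hβ.2]

/-- Write v = αz + ρv' with v' ⟂ z. Flipping the sign of the v'-coordinate removes the cross term by
the parallelogram law; the α² term vanishes by the choice of the shift, and independence turns the
ρ² term into ρ² times the gap, with ρ² = 1 - |α|². -/
theorem IsIsotropic.integral_certificate (h : IsIsotropic ν μ) (hν : IsScalarModel ν s) {z v : E}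
    (hz : ‖z‖ = 1) (hv : ‖v‖ = 1) :
    ∫ x, (certShift ν - min (‖inner 𝕜 x z‖ ^ 2) 1) * ‖inner 𝕜 x v‖ ^ 2 ∂μ
      = certGap ν * (1 - ‖inner 𝕜 v z‖ ^ 2) := by
  have := hν.isProbabilityMeasure
  rw [norm_inner_symm (𝕜 := 𝕜) v z]
  set α := inner 𝕜 z v with hα
  rcases exists_orthonormal_decomp (𝕜 := 𝕜) hz hv with ⟨h1, h2⟩ | ⟨v', ρ, hv', hzv', hρ, h1, h2⟩
  · have h3 : ∀ x : E, ‖inner 𝕜 x v‖ ^ 2 = ‖inner 𝕜 x z‖ ^ 2 := fun x => by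
      conv_lhs => rw [h1, inner_smul_right, norm_mul, h2, one_mul]
    simp_rw [h3]
    rw [(h.measurePreserving hz).integral_comp_of_measurable
      (g := fun y => (certShift ν - min (‖y‖ ^ 2) 1) * ‖y‖ ^ 2) (by fun_prop),
      hν.integral_weight_mul, hα, h2]
    ring
  · rw [← hα] at h1 h2
    have h3 : ∀ x : E, inner 𝕜 x v = α * inner 𝕜 x z + ρ * inner 𝕜 x v' := fun x => by
      conv_lhs => rw [h2, inner_add_right, inner_smul_right, inner_smul_right]
    simp_rw [h3]
    set g : 𝕜 × 𝕜 → ℝ := fun p => (certShift ν - min (‖p.1‖ ^ 2) 1) * ‖α * p.1 + ρ * p.2‖ ^ 2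
      with hg
    have hgm : Measurable g := by
      refine Measurable.mul (by fun_prop) ?_
      exact (((continuous_const.mul continuous_fst).add
        (continuous_const.mul continuous_snd)).norm.pow 2).measurable
    have hρ1 : ‖(ρ : 𝕜)‖ ≤ 1 := by
      rw [RCLike.norm_ofReal, abs_of_nonneg hρ]; nlinarith [sq_nonneg ‖α‖]
    have hα1 : ‖α‖ ≤ 1 := by nlinarith [norm_nonneg α, sq_nonneg ρ]
    have hgi : Integrable g (ν.prod ν) := by
      refine (hν.integrable_prod_norm_sq.const_mul 2).mono' hgm.aestronglyMeasurable
        (ae_of_all _ fun p => ?_)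
      rw [Real.norm_eq_abs, hg, abs_mul, abs_of_nonneg (sq_nonneg ‖_‖)]
      have e1 : ‖α * p.1 + ρ * p.2‖ ≤ ‖p.1‖ + ‖p.2‖ := by
        refine (norm_add_le _ _).trans ?_
        rw [norm_mul, norm_mul]
        exact add_le_add (mul_le_of_le_one_left (norm_nonneg _) hα1)
          (mul_le_of_le_one_left (norm_nonneg _) hρ1)
      calc _ ≤ 1 * ‖α * p.1 + ρ * p.2‖ ^ 2 := by
            gcongr; exact abs_weight_le hν.certShift_mem _ (by positivity)
        _ ≤ 1 * (‖p.1‖ + ‖p.2‖) ^ 2 := by gcongr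
        _ ≤ 2 * (‖p.1‖ ^ 2 + ‖p.2‖ ^ 2) := by nlinarith [sq_nonneg (‖p.1‖ - ‖p.2‖)]
    rw [(h.measurePreserving_pair hz hv' hzv').integral_comp_of_measurable hgm,
      (hν.integral_prod_eq_symm hgi).1]
    have h4 : ∀ p : 𝕜 × 𝕜, (g p + g (p.1, -p.2)) / 2
        = ‖α‖ ^ 2 * ((certShift ν - min (‖p.1‖ ^ 2) 1) * ‖p.1‖ ^ 2)
          + ρ ^ 2 * ((certShift ν - min (‖p.1‖ ^ 2) 1) * ‖p.2‖ ^ 2) := fun p => by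
      have hpar := parallelogram_law_with_norm 𝕜 (α * p.1) (ρ * p.2)
      rw [norm_mul α, norm_mul (ρ : 𝕜), RCLike.norm_ofReal, abs_of_nonneg hρ] at hpar
      simp only [hg, mul_neg, ← sub_eq_add_neg]
      rw [← mul_add, hpar]
      ring
    simp_rw [h4]
    have hw : Integrable (fun x : 𝕜 => certShift ν - min (‖x‖ ^ 2) 1) ν :=
      (integrable_const _).sub integrable_min_norm_sq
    have hw2 : Integrable (fun x : 𝕜 => (certShift ν - min (‖x‖ ^ 2) 1) * ‖x‖ ^ 2) ν := by
      simp_rw [sub_mul]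
      exact (hν.integrable_norm_sq.const_mul _).sub hν.integrable_min_mul
    rw [integral_add ((hw2.comp_fst ν).const_mul _)
        ((hw.mul_prod hν.integrable_norm_sq).const_mul _),
      integral_const_mul, integral_const_mul,
      integral_prod_mul (fun x : 𝕜 => certShift ν - min (‖x‖ ^ 2) 1) (fun x : 𝕜 => ‖x‖ ^ 2),
      integral_fun_fst (fun x : 𝕜 => (certShift ν - min (‖x‖ ^ 2) 1) * ‖x‖ ^ 2),
      hν.integral_weight_mul, hν.integral_norm_sq, smul_zero, mul_zero, zero_add, mul_one,
      ← certGap]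
    have : ρ ^ 2 = 1 - ‖α‖ ^ 2 := by linarith
    rw [this, mul_comm]

/-- Write u = tz + ρv' with t real and v' ⟂ z. Symmetrizing in the v'-coordinate replaces |A + B| by
(|A + B| + |A - B|)/2 ≥ max(|A|, |B|), so the mean is at least |t| and at least ρ times the cross
moment. Reality of ⟨z,u⟩ is essential: over ℂ every measurement vanishes for u = iz. -/
theorem IsIsotropic.le_integral_tangent (h : IsIsotropic ν μ) (hν : IsScalarModel ν s) {z u : E}
    (hz : ‖z‖ = 1) (hu : ‖u‖ = 1) (him : RCLike.im (inner 𝕜 z u) = 0) :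
    min 1 (crossMoment ν) / 2 ≤ ∫ x, |RCLike.re (inner 𝕜 x u * inner 𝕜 z x)| ∂μ := by
  have := hν.isProbabilityMeasure
  have hc : ∀ x : E, inner 𝕜 z x = star (inner 𝕜 x z) := fun x => by
    rw [RCLike.star_def, inner_conj_symm]
  have hre : inner 𝕜 z u = ((RCLike.re (inner 𝕜 z u) : ℝ) : 𝕜) :=
    (RCLike.conj_eq_iff_re.1 (RCLike.conj_eq_iff_im.2 him)).symm
  set t : ℝ := RCLike.re (inner 𝕜 z u) with ht
  simp_rw [hc]
  have hself : ∀ y : 𝕜, |RCLike.re (((t : ℝ) : 𝕜) * y * star y)| = |t| * ‖y‖ ^ 2 := fun y => by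
    have e : RCLike.re (y * star y) = ‖y‖ ^ 2 := by
      rw [RCLike.star_def, RCLike.mul_conj]; norm_cast
    rw [mul_assoc, RCLike.re_ofReal_mul, abs_mul, e, abs_of_nonneg (sq_nonneg ‖y‖)]
  rcases exists_orthonormal_decomp (𝕜 := 𝕜) hz hu with ⟨h1, h2⟩ | ⟨v', ρ, hv', hzv', hρ, h1, h2⟩
  · rw [hre] at h1 h2
    have h3 : ∀ x : E, |RCLike.re (inner 𝕜 x u * star (inner 𝕜 x z))| = ‖inner 𝕜 x z‖ ^ 2 :=
      fun x => by
        rw [h1, inner_smul_right, hself]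
        rw [RCLike.norm_ofReal] at h2
        rw [h2, one_mul]
    simp_rw [h3]
    rw [h.integral_norm_inner_sq hν hz]
    have := min_le_left 1 (crossMoment ν)
    linarith
  · rw [hre] at h1 h2
    rw [RCLike.norm_ofReal, sq_abs] at h1
    have h3 : ∀ x : E, inner 𝕜 x u = (t : 𝕜) * inner 𝕜 x z + ρ * inner 𝕜 x v' := fun x => by
      conv_lhs => rw [h2, inner_add_right, inner_smul_right, inner_smul_right]
    simp_rw [h3]
    set g : 𝕜 × 𝕜 → ℝ := fun p => |RCLike.re (((t : 𝕜) * p.1 + ρ * p.2) * star p.1)| with hg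
    have hg1 : ∀ p, g p = |t * ‖p.1‖ ^ 2 + ρ * RCLike.re (p.2 * star p.1)| := fun p => by
      have e : ‖p.1‖ ^ 2 = RCLike.re (p.1 * star p.1) := by
        rw [RCLike.star_def, RCLike.mul_conj]; norm_cast
      simp only [hg]
      rw [add_mul, map_add, mul_assoc, mul_assoc, RCLike.re_ofReal_mul, RCLike.re_ofReal_mul, e]
    have hgm : Measurable g := by
      have : Continuous g := (RCLike.continuous_re.comp (((continuous_const.mul continuous_fst).add
        (continuous_const.mul continuous_snd)).mul continuous_fst.star)).abs
      exact this.measurable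
    have hgi : Integrable g (ν.prod ν) := by
      refine (((hν.integrable_norm_sq.comp_fst ν).const_mul |t|).add
        (hν.integrable_cross.const_mul ρ)).mono' hgm.aestronglyMeasurable (ae_of_all _ fun p => ?_)
      rw [Real.norm_eq_abs, hg1, abs_abs]
      refine (abs_add_le _ _).trans_eq ?_
      rw [abs_mul, abs_mul, abs_of_nonneg hρ, abs_of_nonneg (sq_nonneg ‖_‖)]
      rfl
    obtain ⟨hs1, hs2⟩ := hν.integral_prod_eq_symm hgi
    rw [(h.measurePreserving_pair hz hv' hzv').integral_comp_of_measurable hgm, hs1]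
    have hneg : ∀ p : 𝕜 × 𝕜, g (p.1, -p.2)
        = |t * ‖p.1‖ ^ 2 - ρ * RCLike.re (p.2 * star p.1)| := fun p => by
      rw [hg1]
      simp only [neg_mul, map_neg, mul_neg, sub_eq_add_neg]
    have b1 : |t| ≤ ∫ p, (g p + g (p.1, -p.2)) / 2 ∂(ν.prod ν) := by
      have e : ∫ p, |t| * ‖p.1‖ ^ 2 ∂(ν.prod ν) = |t| := by
        rw [integral_const_mul, integral_fun_fst (fun x : 𝕜 => ‖x‖ ^ 2), hν.integral_norm_sq]
        simp
      rw [← e]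
      refine integral_mono ((hν.integrable_norm_sq.comp_fst ν).const_mul |t|) hs2 fun p => ?_
      change |t| * ‖p.1‖ ^ 2 ≤ (g p + g (p.1, -p.2)) / 2
      rw [hneg, hg1]
      have := abs_add_le (t * ‖p.1‖ ^ 2 + ρ * RCLike.re (p.2 * star p.1))
        (t * ‖p.1‖ ^ 2 - ρ * RCLike.re (p.2 * star p.1))
      rw [add_add_sub_cancel, ← two_mul, abs_mul, abs_mul, abs_of_nonneg (sq_nonneg ‖_‖),
        abs_two] at this
      linarith
    have b2 : ρ * crossMoment ν ≤ ∫ p, (g p + g (p.1, -p.2)) / 2 ∂(ν.prod ν) := by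
      rw [crossMoment, ← integral_const_mul]
      refine integral_mono (hν.integrable_cross.const_mul ρ) hs2 fun p => ?_
      change ρ * |RCLike.re (p.2 * star p.1)| ≤ (g p + g (p.1, -p.2)) / 2
      rw [hneg, hg1]
      have := abs_sub (t * ‖p.1‖ ^ 2 + ρ * RCLike.re (p.2 * star p.1))
        (t * ‖p.1‖ ^ 2 - ρ * RCLike.re (p.2 * star p.1))
      rw [add_sub_sub_cancel, ← two_mul, abs_mul, abs_mul, abs_of_nonneg hρ, abs_two] at this
      linarith
    have hk := hν.crossMoment_pos
    -- Since t² + ρ² = 1, at least one of |t| and ρ is at least 1/2.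
    rcases le_or_gt (1 / 2) |t| with ht2 | ht2
    · have := min_le_left 1 (crossMoment ν)
      linarith
    · have hρ2 : 1 / 2 ≤ ρ := by
        have : t ^ 2 < (1 / 2) ^ 2 := by rw [← sq_abs t]; gcongr
        nlinarith
      have := min_le_right 1 (crossMoment ν)
      nlinarith

end Isotropic

/-! ### Passing from net points to all unit vectors. -/

section Perturbation

variable {𝕜 E : Type*} [RCLike 𝕜] [NormedAddCommGroup E] [InnerProductSpace 𝕜 E]
  {m : ℕ} {a : Fin m → E}

/-- A frame bound on a `1/2`-net of the unit sphere extends to the whole space. -/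
theorem frame_bound_of_net (N : Finset E)
    (hnet : ∀ v : E, ‖v‖ = 1 → ∃ v' ∈ N, ‖v - v'‖ ≤ 1 / 2)
    (hN : ∀ v ∈ N, ∑ i, ‖inner 𝕜 (a i) v‖ ^ 2 ≤ m * 2) (v : E) :
    ∑ i, ‖inner 𝕜 (a i) v‖ ^ 2 ≤ m * (8 * ‖v‖ ^ 2) := by
  let A : E →L[𝕜] EuclideanSpace 𝕜 (Fin m) :=
    (PiLp.continuousLinearEquiv 2 𝕜 (fun _ : Fin m => 𝕜)).symm.toContinuousLinearMap ∘L
      ContinuousLinearMap.pi fun i => innerSL 𝕜 (a i)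
  have hA : ∀ v, ‖A v‖ ^ 2 = ∑ i, ‖inner 𝕜 (a i) v‖ ^ 2 := fun v => by
    rw [EuclideanSpace.norm_sq_eq]
    rfl
  have h2 : ∀ v ∈ N, ‖A v‖ ≤ √(m * 2) := fun v hv =>
    Real.le_sqrt_of_sq_le (by rw [hA]; exact hN v hv)
  -- The operator norm occurs on both sides; mesh 1/2 allows it to be absorbed, giving ‖A‖ ≤ 2√(2m),
  -- whose square is the frame constant 8m.
  have hop : ‖A‖ ≤ √(m * 2) + ‖A‖ * (1 / 2) := by
    refine A.opNorm_le_bound (by positivity) fun x => ?_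
    rcases eq_or_ne x 0 with rfl | hx
    · simp
    have hn : ‖x‖ ≠ 0 := norm_ne_zero_iff.2 hx
    set y : E := ((‖x‖⁻¹ : ℝ) : 𝕜) • x with hy
    have hy1 : ‖y‖ = 1 := by rw [hy, norm_smul]; simp [hn]
    have hxy : x = ((‖x‖ : ℝ) : 𝕜) • y := by
      rw [hy, smul_smul, ← RCLike.ofReal_mul, mul_inv_cancel₀ hn]; simp
    obtain ⟨y', hy'N, hy'⟩ := hnet y hy1
    have hAy : ‖A y‖ ≤ √(m * 2) + ‖A‖ * (1 / 2) := by
      calc ‖A y‖ = ‖A y' + A (y - y')‖ := by rw [← map_add, add_sub_cancel]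
        _ ≤ ‖A y'‖ + ‖A (y - y')‖ := norm_add_le _ _
        _ ≤ √(m * 2) + ‖A‖ * (1 / 2) := by
          refine add_le_add (h2 y' hy'N) ((A.le_opNorm _).trans ?_)
          gcongr
    calc ‖A x‖ = ‖x‖ * ‖A y‖ := by
          conv_lhs => rw [hxy, map_smul, norm_smul]
          simp
      _ ≤ ‖x‖ * (√(m * 2) + ‖A‖ * (1 / 2)) := by gcongr
      _ = _ := mul_comm _ _
  have hop2 : ‖A‖ ≤ 2 * √(m * 2) := by linarith
  rw [← hA]
  calc ‖A v‖ ^ 2 ≤ (2 * √(m * 2) * ‖v‖) ^ 2 := by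
        have := A.le_of_opNorm_le hop2 v
        gcongr
    _ = m * (8 * ‖v‖ ^ 2) := by
        rw [mul_pow, mul_pow, Real.sq_sqrt (by positivity)]; ring

theorem sum_mul_le_of_frame (h : ∀ v : E, ∑ i, ‖inner 𝕜 (a i) v‖ ^ 2 ≤ m * (8 * ‖v‖ ^ 2))
    (x y : E) : ∑ i, ‖inner 𝕜 (a i) x‖ * ‖inner 𝕜 (a i) y‖ ≤ m * (8 * (‖x‖ * ‖y‖)) := by
  refine abs_le_of_sq_le_sq' ?_ (by positivity) |>.2
  calc _ ≤ (∑ i, ‖inner 𝕜 (a i) x‖ ^ 2) * ∑ i, ‖inner 𝕜 (a i) y‖ ^ 2 :=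
        Finset.sum_mul_sq_le_sq_mul_sq _ _ _
    _ ≤ (m * (8 * ‖x‖ ^ 2)) * (m * (8 * ‖y‖ ^ 2)) := by
        have := h x
        have := h y
        gcongr
    _ = _ := by ring

theorem sum_norm_le_of_frame (h : ∀ v : E, ∑ i, ‖inner 𝕜 (a i) v‖ ^ 2 ≤ m * (8 * ‖v‖ ^ 2))
    (x : E) : ∑ i, ‖inner 𝕜 (a i) x‖ ≤ m * (3 * ‖x‖) := by
  refine abs_le_of_sq_le_sq' ?_ (by positivity) |>.2
  calc _ ≤ (m : ℝ) * ∑ i, ‖inner 𝕜 (a i) x‖ ^ 2 := by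
        have := sq_sum_le_card_mul_sum_sq (s := Finset.univ) (f := fun i => ‖inner 𝕜 (a i) x‖)
        simpa using this
    _ ≤ m * (m * (8 * ‖x‖ ^ 2)) := by
        have := h x
        gcongr
    _ ≤ _ := by nlinarith [mul_nonneg (sq_nonneg (m : ℝ)) (sq_nonneg ‖x‖)]

theorem abs_re_mul_sub_le (x u z u' z' : E) :
    |RCLike.re (inner 𝕜 x u' * inner 𝕜 z' x)| - |RCLike.re (inner 𝕜 x u * inner 𝕜 z x)|
      ≤ ‖inner 𝕜 x (u - u')‖ * ‖inner 𝕜 x z‖ + ‖inner 𝕜 x u'‖ * ‖inner 𝕜 x (z - z')‖ := by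
  have h1 : inner 𝕜 x u' * inner 𝕜 z' x - inner 𝕜 x u * inner 𝕜 z x
      = -(inner 𝕜 x (u - u') * inner 𝕜 z x + inner 𝕜 x u' * inner 𝕜 (z - z') x) := by
    rw [inner_sub_right, inner_sub_left]; ring
  calc _ ≤ |RCLike.re (inner 𝕜 x u' * inner 𝕜 z' x) - RCLike.re (inner 𝕜 x u * inner 𝕜 z x)| :=
        abs_sub_abs_le_abs_sub _ _
    _ ≤ ‖inner 𝕜 x u' * inner 𝕜 z' x - inner 𝕜 x u * inner 𝕜 z x‖ := by
        rw [← map_sub]; exact RCLike.abs_re_le_norm _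
    _ ≤ _ := by
        rw [h1, norm_neg]
        refine (norm_add_le _ _).trans ?_
        rw [norm_mul, norm_mul, norm_inner_symm (𝕜 := 𝕜) z x, norm_inner_symm (𝕜 := 𝕜) (z - z') x]

/-- The truncated square is the square of the truncation to [0, 1], hence 2-Lipschitz. -/
theorem abs_min_sq_sub_le {s t : ℝ} (hs : 0 ≤ s) (ht : 0 ≤ t) :
    |min (s ^ 2) 1 - min (t ^ 2) 1| ≤ 2 * |s - t| := by
  have key : ∀ r : ℝ, 0 ≤ r → min (r ^ 2) 1 = (min r 1) ^ 2 := fun r hr => by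
    rcases le_total r 1 with h | h
    · rw [min_eq_left h, min_eq_left (by nlinarith)]
    · rw [min_eq_right h, min_eq_right (by nlinarith), one_pow]
  rw [key s hs, key t ht, sq_sub_sq, abs_mul]
  have h1 : |min s 1 - min t 1| ≤ |s - t| := by
    simpa using abs_min_sub_min_le_max s 1 t 1
  have h2 : |min s 1 + min t 1| ≤ 2 := by
    have := min_le_right s 1
    have := min_le_right t 1
    rw [abs_of_nonneg (by positivity)]
    linarith
  exact mul_le_mul h2 h1 (abs_nonneg _) (by norm_num)

/-- Moving v costs a difference of squares, with weight at most 1. Moving z would produce a cubic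
term, which the frame bound does not control; so |⟨x,v'⟩|² is split at K. Below K the Lipschitz
bound on the weight is used, and on the excess the trivial bound that the weight changes by at most
1. -/
theorem abs_weight_mul_sub_le {β K : ℝ} (hβ : 0 ≤ β ∧ β ≤ 1) (hK : 0 ≤ K) (x z v z' v' : E) :
    |(β - min (‖inner 𝕜 x z‖ ^ 2) 1) * ‖inner 𝕜 x v‖ ^ 2
      - (β - min (‖inner 𝕜 x z'‖ ^ 2) 1) * ‖inner 𝕜 x v'‖ ^ 2|
      ≤ ‖inner 𝕜 x (v - v')‖ * ‖inner 𝕜 x v‖ + ‖inner 𝕜 x (v - v')‖ * ‖inner 𝕜 x v'‖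
        + (2 * K * ‖inner 𝕜 x (z - z')‖ + max (‖inner 𝕜 x v'‖ ^ 2 - K) 0) := by
  set p := ‖inner 𝕜 x v‖
  set q := ‖inner 𝕜 x v'‖
  set d := |min (‖inner 𝕜 x z‖ ^ 2) 1 - min (‖inner 𝕜 x z'‖ ^ 2) 1| with hd
  have hpq : |p - q| ≤ ‖inner 𝕜 x (v - v')‖ := by
    rw [inner_sub_right]; exact abs_norm_sub_norm_le _ _
  have hd2 : d ≤ 2 * ‖inner 𝕜 x (z - z')‖ := by
    refine (abs_min_sq_sub_le (norm_nonneg _) (norm_nonneg _)).trans ?_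
    gcongr
    rw [inner_sub_right]; exact abs_norm_sub_norm_le _ _
  have hd1 : d ≤ 1 := by
    have h1 := min_le_right (‖inner 𝕜 x z‖ ^ 2) 1
    have h2 := min_le_right (‖inner 𝕜 x z'‖ ^ 2) 1
    have h3 : 0 ≤ min (‖inner 𝕜 x z‖ ^ 2) 1 := by positivity
    have h4 : 0 ≤ min (‖inner 𝕜 x z'‖ ^ 2) 1 := by positivity
    rw [hd, abs_le]
    constructor <;> linarith
  have hd0 : 0 ≤ d := abs_nonneg _
  have e : (β - min (‖inner 𝕜 x z‖ ^ 2) 1) * p ^ 2 - (β - min (‖inner 𝕜 x z'‖ ^ 2) 1) * q ^ 2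
      = (β - min (‖inner 𝕜 x z‖ ^ 2) 1) * ((p - q) * (p + q))
        - (min (‖inner 𝕜 x z‖ ^ 2) 1 - min (‖inner 𝕜 x z'‖ ^ 2) 1) * q ^ 2 := by ring
  rw [e]
  refine (abs_sub _ _).trans (add_le_add ?_ ?_)
  · rw [abs_mul, abs_mul, abs_of_nonneg (by positivity : 0 ≤ p + q), ← mul_add]
    calc _ ≤ 1 * (|p - q| * (p + q)) := by
          gcongr; exact abs_weight_le hβ _ (by positivity)
      _ ≤ _ := by rw [one_mul]; gcongr
  · rw [abs_mul, ← hd, abs_of_nonneg (sq_nonneg q)]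
    rcases le_total (q ^ 2) K with h | h
    · rw [max_eq_right (by linarith)]
      nlinarith
    · rw [max_eq_left (by linarith)]
      nlinarith

theorem abs_norm_sq_inner_sub_le {z v z' v' : E} (hz : ‖z‖ = 1) (hv : ‖v‖ = 1)
    (hz' : ‖z'‖ = 1) (hv' : ‖v'‖ = 1) {ε : ℝ}
    (hzz : ‖z - z'‖ ≤ ε) (hvv : ‖v - v'‖ ≤ ε) :
    |‖inner 𝕜 v z‖ ^ 2 - ‖inner 𝕜 v' z'‖ ^ 2| ≤ 4 * ε := by
  have h1 : ‖inner 𝕜 v z‖ ≤ 1 := by simpa [hz, hv] using norm_inner_le_norm (𝕜 := 𝕜) v z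
  have h2 : ‖inner 𝕜 v' z'‖ ≤ 1 := by simpa [hz', hv'] using norm_inner_le_norm (𝕜 := 𝕜) v' z'
  have h3 : |‖inner 𝕜 v z‖ - ‖inner 𝕜 v' z'‖| ≤ 2 * ε := by
    refine (abs_norm_sub_norm_le _ _).trans ?_
    have : inner 𝕜 v z - inner 𝕜 v' z' = inner 𝕜 (v - v') z + inner 𝕜 v' (z - z') := by
      rw [inner_sub_left, inner_sub_right]; ring
    rw [this]
    have e1 := norm_inner_le_norm (𝕜 := 𝕜) (v - v') z
    have e2 := norm_inner_le_norm (𝕜 := 𝕜) v' (z - z')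
    rw [hz, mul_one] at e1
    rw [hv', one_mul] at e2
    exact (norm_add_le _ _).trans (by linarith)
  rw [sq_sub_sq, abs_mul, abs_of_nonneg (by positivity : 0 ≤ ‖inner 𝕜 v z‖ + ‖inner 𝕜 v' z'‖)]
  nlinarith [abs_nonneg (‖inner 𝕜 v z‖ - ‖inner 𝕜 v' z'‖), norm_nonneg (inner 𝕜 v z),
    norm_nonneg (inner 𝕜 v' z')]

theorem sum_tangent_sub_le (hframe : ∀ v : E, ∑ i, ‖inner 𝕜 (a i) v‖ ^ 2 ≤ m * (8 * ‖v‖ ^ 2))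
    {z u z' u' : E} (hz : ‖z‖ = 1) (hu' : ‖u'‖ = 1) {ε : ℝ} (hzz : ‖z - z'‖ ≤ ε)
    (huu : ‖u - u'‖ ≤ ε) :
    ∑ i, |RCLike.re (inner 𝕜 (a i) u' * inner 𝕜 z' (a i))|
      - ∑ i, |RCLike.re (inner 𝕜 (a i) u * inner 𝕜 z (a i))| ≤ m * (16 * ε) := by
  have hm0 : (0 : ℝ) ≤ m := m.cast_nonneg
  rw [← Finset.sum_sub_distrib]
  refine (Finset.sum_le_sum fun i _ => abs_re_mul_sub_le (𝕜 := 𝕜) (a i) u z u' z').trans ?_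
  rw [Finset.sum_add_distrib]
  have e1 := sum_mul_le_of_frame hframe (u - u') z
  have e2 := sum_mul_le_of_frame hframe u' (z - z')
  rw [hz, mul_one] at e1
  rw [hu', one_mul] at e2
  nlinarith [mul_le_mul_of_nonneg_left hzz hm0, mul_le_mul_of_nonneg_left huu hm0]

theorem abs_sum_certificate_sub_le
    (hframe : ∀ v : E, ∑ i, ‖inner 𝕜 (a i) v‖ ^ 2 ≤ m * (8 * ‖v‖ ^ 2)) {β K : ℝ}
    (hβ : 0 ≤ β ∧ β ≤ 1) (hK : 0 ≤ K) {z v z' v' : E} (hv : ‖v‖ = 1) (hv' : ‖v'‖ = 1) {ε : ℝ}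
    (hzz : ‖z - z'‖ ≤ ε) (hvv : ‖v - v'‖ ≤ ε) :
    |∑ i, (β - min (‖inner 𝕜 (a i) z‖ ^ 2) 1) * ‖inner 𝕜 (a i) v‖ ^ 2
      - ∑ i, (β - min (‖inner 𝕜 (a i) z'‖ ^ 2) 1) * ‖inner 𝕜 (a i) v'‖ ^ 2|
      ≤ m * (16 * ε) + m * (6 * K * ε) + ∑ i, max (‖inner 𝕜 (a i) v'‖ ^ 2 - K) 0 := by
  have hm0 : (0 : ℝ) ≤ m := m.cast_nonneg
  rw [← Finset.sum_sub_distrib]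
  refine (Finset.abs_sum_le_sum_abs _ _).trans ?_
  refine (Finset.sum_le_sum fun i _ => abs_weight_mul_sub_le hβ hK (a i) z v z' v').trans ?_
  rw [Finset.sum_add_distrib, Finset.sum_add_distrib, Finset.sum_add_distrib, ← Finset.mul_sum]
  have e1 := sum_mul_le_of_frame hframe (v - v') v
  have e2 := sum_mul_le_of_frame hframe (v - v') v'
  have e3 := sum_norm_le_of_frame hframe (z - z')
  rw [hv, mul_one] at e1
  rw [hv', mul_one] at e2
  have e4 : 2 * K * ∑ i, ‖inner 𝕜 (a i) (z - z')‖ ≤ 2 * K * (m * (3 * ε)) := by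
    gcongr
    exact e3.trans (by gcongr)
  nlinarith [mul_le_mul_of_nonneg_left hvv hm0]

end Perturbation

/-! ### The regular event and its constants. -/

section Regularity

variable {𝕜 : Type*} [RCLike 𝕜] [MeasurableSpace 𝕜] [BorelSpace 𝕜]

/-- The certificate weights `β - min (|⟨a, z⟩|²) 1`. -/
noncomputable def certWeight {E : Type*} [NormedAddCommGroup E] [InnerProductSpace 𝕜 E]
    (ν : Measure 𝕜) {m : ℕ} (a : Fin m → E) (z : E) (i : Fin m) : ℝ :=
  certShift ν - min (‖inner 𝕜 (a i) z‖ ^ 2) 1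

theorem card_mul_exp_le {k ρ m : ℝ} (hk : k ≤ Real.exp (ρ / 2 * m)) :
    k * (2 * Real.exp (-ρ * m)) ≤ 2 * Real.exp (-(ρ / 2) * m) := by
  have : Real.exp (ρ / 2 * m) * Real.exp (-ρ * m) = Real.exp (-(ρ / 2) * m) := by
    rw [← Real.exp_add]; ring_nf
  nlinarith [Real.exp_pos (-ρ * m)]

theorem norm_eq_one_of_mem_prod {E : Type*} [NormedAddCommGroup E] {p : E × E}
    (h : ‖p.1‖ = 1 ∧ ‖p.2‖ = 1) : ‖p‖ ≤ 1 := by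
  rw [Prod.norm_def, h.1, h.2, max_self]

universe u

set_option maxHeartbeats 1000000 in
/-- Independent isotropic vectors are regular with overwhelming probability. -/
theorem exists_regular_event {ν : Measure 𝕜} {s : ℝ} (hν : IsScalarModel ν s) :
    ∃ c₀ γ c₁ c₂ δ : ℝ, 0 < c₀ ∧ 0 < γ ∧ 0 < c₁ ∧ 0 < δ ∧ δ * (1 + 8 / c₁) < c₂ ∧
      ∀ (E : Type u) [NormedAddCommGroup E] [InnerProductSpace 𝕜 E] [NormedSpace ℝ E]
        [FiniteDimensional ℝ E] [MeasurableSpace E] [BorelSpace E] (μ : Measure E)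
        [IsProbabilityMeasure μ], IsIsotropic ν μ →
        ∀ m : ℕ, c₀ * Module.finrank ℝ E ≤ m →
        ∃ G : Set (Fin m → E), MeasurableSet G ∧
          (Measure.pi fun _ : Fin m => μ).real Gᶜ ≤ 8 * Real.exp (-γ * m) ∧
          ∀ a ∈ G, IsRegular (𝕜 := 𝕜) a (certWeight ν a) c₁ c₂ δ := by
  have := hν.isProbabilityMeasure
  set c : ℝ := min 1 (crossMoment ν) / 2 with hc
  have hcpos : 0 < c := half_pos (lt_min one_pos hν.crossMoment_pos)
  set c₂ := certGap ν with hc₂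
  have hc₂pos : 0 < c₂ := hν.certGap_pos
  -- Chosen so that δ(1 + 8/c₁) = c₂/2 for the final tangent constant c₁ = c/2.
  set δ : ℝ := c₂ / (2 * (1 + 8 / (c / 2))) with hδ
  have hδpos : 0 < δ := by positivity
  set M₄ : ℝ := ∫ x, ‖x‖ ^ 4 ∂ν with hM₄
  have hM₄0 : 0 ≤ M₄ := integral_nonneg fun x => by positivity
  set K : ℝ := 8 * (M₄ + 1) / δ with hK
  have hKpos : 0 < K := by positivity
  have htail : M₄ / K ≤ δ / 8 := by
    rw [hK, div_le_div_iff₀ (by positivity) (by norm_num), mul_div_cancel₀ _ hδpos.ne']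
    linarith
  -- The three bounds serve the frame net, the tangent perturbation 16ε ≤ c/4, and the certificate
  -- perturbation, where 16ε + 6Kε comes from the sums and 4ε from the target form.
  set ε : ℝ := min (1 / 2) (min (c / 64) (δ / (2 * (20 + 6 * K)))) with hε
  have hεpos : 0 < ε := lt_min (by norm_num) (lt_min (by positivity) (by positivity))
  have hε1 : ε ≤ 1 / 2 := min_le_left _ _
  have hε2 : ε ≤ c / 64 := (min_le_right _ _).trans (min_le_left _ _)
  have hε3 : (20 + 6 * K) * ε ≤ δ / 2 := by
    have : ε ≤ δ / (2 * (20 + 6 * K)) := (min_le_right _ _).trans (min_le_right _ _)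
    rw [le_div_iff₀ (by positivity)] at this
    linarith
  -- Sampling error: 1 keeps the frame sums below 2m on the net; c/4 leaves c - c/4 - c/4 = c/2 in
  -- the tangent bound; δ/8 makes the certificate total δ/2 + 3δ/8 < δ, counting its own error, the
  -- tail mean and the tail error.
  set δ₀ : ℝ := min 1 (min (c / 4) (δ / 8)) with hδ₀
  have hδ₀pos : 0 < δ₀ := lt_min one_pos (lt_min (by positivity) (by positivity))
  have hδ1 : δ₀ ≤ 1 := min_le_left _ _
  have hδ2 : δ₀ ≤ c / 4 := (min_le_right _ _).trans (min_le_left _ _)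
  have hδ3 : δ₀ ≤ δ / 8 := (min_le_right _ _).trans (min_le_right _ _)
  set M : ℝ := ∫ x, Real.exp (s * ‖x‖ ^ 2) ∂ν with hM
  have hMpos : 0 < M := integral_exp_pos hν.integrable_exp
  have hs := hν.pos
  set ρ : ℝ := chernoffRate (s / 2) M δ₀ with hρ
  have hρpos : 0 < ρ := chernoffRate_pos (half_pos hs) hMpos hδ₀pos
  have hlog : 0 < Real.log (1 + 2 / ε) := Real.log_pos (by
    have : 0 < 2 / ε := by positivity
    linarith)
  refine ⟨4 * Real.log (1 + 2 / ε) / ρ, ρ / 2, c / 2, c₂, δ, by positivity, by positivity,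
    by positivity, hδpos, ?_, ?_⟩
  · have h1 : 0 < 1 + 8 / (c / 2) := by positivity
    have h2 : δ * (1 + 8 / (c / 2)) = c₂ / 2 := by
      rw [hδ]; field_simp
    rw [h2]; linarith
  intro E _ _ _ _ _ _ μ _ hμ m hm
  -- The nets of pairs live in dimension 2 dim E; the lower bound on m makes their cardinality
  -- consume only half of the Chernoff rate.
  have hcard : ∀ d : ℕ, d ≤ 2 * Module.finrank ℝ E →
      (1 + 2 / ε) ^ d ≤ Real.exp (ρ / 2 * m) := fun d hd => by
    have h1 : (d : ℝ) ≤ 2 * Module.finrank ℝ E := by exact_mod_cast hd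
    rw [← Real.exp_log (by positivity : 0 < 1 + 2 / ε), ← Real.exp_nat_mul, Real.exp_le_exp]
    rw [div_mul_eq_mul_div, div_le_iff₀ hρpos] at hm
    nlinarith
  have hmeas : ∀ v : E, Measurable fun x : E => inner 𝕜 x v := measurable_inner_right
  -- The nets must be internal: the expectation formulas require unit vectors, and for the tangent
  -- bound also a real inner product, at the net points themselves.
  obtain ⟨N₁, hN₁T, hN₁c, hN₁⟩ := exists_net hεpos {v : E | ‖v‖ = 1} fun v hv => le_of_eq hv
  obtain ⟨N₂, hN₂T, hN₂c, hN₂⟩ := exists_net hεpos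
    {p : E × E | (‖p.1‖ = 1 ∧ ‖p.2‖ = 1) ∧ RCLike.im (inner 𝕜 p.1 p.2) = 0}
    fun p hp => norm_eq_one_of_mem_prod hp.1
  obtain ⟨N₃, hN₃T, hN₃c, hN₃⟩ := exists_net hεpos {p : E × E | ‖p.1‖ = 1 ∧ ‖p.2‖ = 1}
    fun p hp => norm_eq_one_of_mem_prod hp
  have hN₁c' := hN₁c.trans (hcard _ (by lia))
  have hN₂c' := hN₂c.trans (hcard _ (by rw [Module.finrank_prod]; lia))
  have hN₃c' := hN₃c.trans (hcard _ (by rw [Module.finrank_prod]; lia))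
  have hb₁ := fun v (hv : v ∈ N₁) => hμ.integrable_exp hν (f := fun x => ‖inner 𝕜 x v‖ ^ 2)
    (by have := hmeas v; fun_prop) (hN₁T v hv) (hN₁T v hv) fun x => by
      rw [abs_of_nonneg (sq_nonneg ‖_‖)]; nlinarith [sq_nonneg ‖inner 𝕜 x v‖]
  have hb₂m : ∀ p : E × E, Measurable fun x : E =>
      |RCLike.re (inner 𝕜 x p.2 * inner 𝕜 p.1 x)| := fun p =>
    (RCLike.continuous_re.comp ((continuous_id.inner continuous_const).mul
      (continuous_const.inner continuous_id))).abs.measurable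
  have hb₂ := fun p (hp : p ∈ N₂) => hμ.integrable_exp hν
    (f := fun x => |RCLike.re (inner 𝕜 x p.2 * inner 𝕜 p.1 x)|)
    (hb₂m p) (hN₂T p hp).1.1 (hN₂T p hp).1.2 fun x => by
      rw [abs_abs, ← inner_conj_symm p.1 x]
      exact abs_re_mul_star_le (inner 𝕜 x p.1) (inner 𝕜 x p.2)
  have hb₃ := fun p (hp : p ∈ N₃) => hμ.integrable_exp hν
    (f := fun x => (certShift ν - min (‖inner 𝕜 x p.1‖ ^ 2) 1) * ‖inner 𝕜 x p.2‖ ^ 2)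
    (by have := hmeas p.1; have := hmeas p.2; fun_prop) (hN₃T p hp).1 (hN₃T p hp).2 fun x => by
      rw [abs_mul, abs_of_nonneg (sq_nonneg ‖inner 𝕜 x p.2‖)]
      have := abs_weight_le hν.certShift_mem (‖inner 𝕜 x p.1‖ ^ 2) (sq_nonneg _)
      nlinarith [sq_nonneg ‖inner 𝕜 x p.1‖, sq_nonneg ‖inner 𝕜 x p.2‖]
  have hb₄ := fun p (hp : p ∈ N₃) => hμ.integrable_exp hν
    (f := fun x => max (‖inner 𝕜 x p.2‖ ^ 2 - K) 0)
    (by have := hmeas p.2; fun_prop) (hN₃T p hp).2 (hN₃T p hp).2 fun x => by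
      rw [abs_of_nonneg (le_max_right _ _)]
      exact max_le (by nlinarith [sq_nonneg ‖inner 𝕜 x p.2‖]) (by positivity)
  obtain ⟨G₁, hG₁m, hG₁p, hG₁⟩ := exists_measurableSet_concentration (μ := μ) N₁
    (f := fun v x => ‖inner 𝕜 x v‖ ^ 2) (fun v _ => by have := hmeas v; fun_prop)
    (half_pos hs) hMpos hδ₀pos (fun v hv => (hb₁ v hv).1) (fun v hv => (hb₁ v hv).2) m
  obtain ⟨G₂, hG₂m, hG₂p, hG₂⟩ := exists_measurableSet_concentration (μ := μ) N₂
    (f := fun p x => |RCLike.re (inner 𝕜 x p.2 * inner 𝕜 p.1 x)|) (fun p _ => hb₂m p)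
    (half_pos hs) hMpos hδ₀pos (fun v hv => (hb₂ v hv).1) (fun v hv => (hb₂ v hv).2) m
  obtain ⟨G₃, hG₃m, hG₃p, hG₃⟩ := exists_measurableSet_concentration (μ := μ) N₃
    (f := fun p x => (certShift ν - min (‖inner 𝕜 x p.1‖ ^ 2) 1) * ‖inner 𝕜 x p.2‖ ^ 2)
    (fun p _ => by have := hmeas p.1; have := hmeas p.2; fun_prop)
    (half_pos hs) hMpos hδ₀pos (fun v hv => (hb₃ v hv).1) (fun v hv => (hb₃ v hv).2) m
  obtain ⟨G₄, hG₄m, hG₄p, hG₄⟩ := exists_measurableSet_concentration (μ := μ) N₃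
    (f := fun p x => max (‖inner 𝕜 x p.2‖ ^ 2 - K) 0)
    (fun p _ => by have := hmeas p.2; fun_prop)
    (half_pos hs) hMpos hδ₀pos (fun v hv => (hb₄ v hv).1) (fun v hv => (hb₄ v hv).2) m
  replace hG₁p := hG₁p.trans (card_mul_exp_le hN₁c')
  replace hG₂p := hG₂p.trans (card_mul_exp_le hN₂c')
  replace hG₃p := hG₃p.trans (card_mul_exp_le hN₃c')
  replace hG₄p := hG₄p.trans (card_mul_exp_le hN₃c')
  refine ⟨(G₁ ∩ G₂) ∩ (G₃ ∩ G₄), (hG₁m.inter hG₂m).inter (hG₃m.inter hG₄m), ?_, ?_⟩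
  -- Four families, each failing with probability at most 2 exp(-(ρ/2)m), account for the constant
  -- 8.
  · rw [Set.compl_inter, Set.compl_inter, Set.compl_inter]
    have h1 := measureReal_union_le (μ := Measure.pi fun _ : Fin m => μ) (G₁ᶜ ∪ G₂ᶜ) (G₃ᶜ ∪ G₄ᶜ)
    have h2 := measureReal_union_le (μ := Measure.pi fun _ : Fin m => μ) G₁ᶜ G₂ᶜ
    have h3 := measureReal_union_le (μ := Measure.pi fun _ : Fin m => μ) G₃ᶜ G₄ᶜ
    linarith
  rintro a ⟨⟨ha₁, ha₂⟩, ha₃, ha₄⟩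
  have hm0 : (0 : ℝ) ≤ m := m.cast_nonneg
  have hframe : ∀ v : E, ∑ i, ‖inner 𝕜 (a i) v‖ ^ 2 ≤ m * (8 * ‖v‖ ^ 2) := by
    refine frame_bound_of_net N₁ (fun v hv => ?_) fun v hv => ?_
    · obtain ⟨v', hv', hle⟩ := hN₁ v hv
      exact ⟨v', hv', hle.trans hε1⟩
    · have h1 := (abs_le.1 (hG₁ a ha₁ v hv)).2
      rw [hμ.integral_norm_inner_sq hν (hN₁T v hv)] at h1
      nlinarith
  refine ⟨hframe, fun z u hz hu him => ?_, fun z v hz hv => ?_⟩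
  · obtain ⟨⟨z', u'⟩, hp, hle⟩ := hN₂ (z, u) ⟨⟨hz, hu⟩, him⟩
    obtain ⟨⟨hz', hu'⟩, him'⟩ := hN₂T _ hp
    simp only at hz' hu' him'
    have hzz : ‖z - z'‖ ≤ ε := (norm_fst_le ((z, u) - (z', u'))).trans hle
    have huu : ‖u - u'‖ ≤ ε := (norm_snd_le ((z, u) - (z', u'))).trans hle
    have h1 := (abs_le.1 (hG₂ a ha₂ _ hp)).1
    simp only at h1
    have h2 := hμ.le_integral_tangent hν hz' hu' him'
    have h3 : ∑ i, |RCLike.re (inner 𝕜 (a i) u' * inner 𝕜 z' (a i))|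
        - ∑ i, |RCLike.re (inner 𝕜 (a i) u * inner 𝕜 z (a i))| ≤ m * (16 * ε) :=
      sum_tangent_sub_le hframe hz hu' hzz huu
    have h4 : m * c ≤ m * ∫ x, |RCLike.re (inner 𝕜 x u' * inner 𝕜 z' x)| ∂μ := by gcongr
    have h5 : m * (16 * ε) ≤ m * (c / 4) := by gcongr; linarith
    have h6 : m * δ₀ ≤ m * (c / 4) := by gcongr
    linarith
  · obtain ⟨⟨z', v'⟩, hp, hle⟩ := hN₃ (z, v) ⟨hz, hv⟩
    obtain ⟨hz', hv'⟩ := hN₃T _ hp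
    simp only at hz' hv'
    have hzz : ‖z - z'‖ ≤ ε := (norm_fst_le ((z, v) - (z', v'))).trans hle
    have hvv : ‖v - v'‖ ≤ ε := (norm_snd_le ((z, v) - (z', v'))).trans hle
    have h1 := hG₃ a ha₃ _ hp
    simp only at h1
    rw [hμ.integral_certificate hν hz' hv'] at h1
    have h2 := (abs_le.1 (hG₄ a ha₄ _ hp)).2
    simp only at h2
    have h3 := (hμ.integral_tail_le hν hv' hKpos).trans htail
    have h4 : |∑ i, certWeight ν a z i * ‖inner 𝕜 (a i) v‖ ^ 2
        - ∑ i, (certShift ν - min (‖inner 𝕜 (a i) z'‖ ^ 2) 1) * ‖inner 𝕜 (a i) v'‖ ^ 2|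
        ≤ m * (16 * ε) + m * (6 * K * ε) + ∑ i, max (‖inner 𝕜 (a i) v'‖ ^ 2 - K) 0 :=
      abs_sum_certificate_sub_le hframe hν.certShift_mem hKpos.le hv hv' hzz hvv
    have h5 := abs_norm_sq_inner_sub_le (𝕜 := 𝕜) hz hv hz' hv' hzz hvv
    have h6 : |m * (c₂ * (1 - ‖inner 𝕜 v' z'‖ ^ 2)) - m * (c₂ * (1 - ‖inner 𝕜 v z‖ ^ 2))|
        ≤ m * (4 * ε) := by
      have : m * (c₂ * (1 - ‖inner 𝕜 v' z'‖ ^ 2)) - m * (c₂ * (1 - ‖inner 𝕜 v z‖ ^ 2))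
          = m * (c₂ * (‖inner 𝕜 v z‖ ^ 2 - ‖inner 𝕜 v' z'‖ ^ 2)) := by ring
      rw [this, abs_mul, abs_of_nonneg hm0, abs_mul, abs_of_pos hc₂pos]
      have hle1 : c₂ ≤ 1 := hν.certGap_le
      refine mul_le_mul_of_nonneg_left ?_ hm0
      nlinarith [abs_nonneg (‖inner 𝕜 v z‖ ^ 2 - ‖inner 𝕜 v' z'‖ ^ 2)]
    have h7 : m * ((20 + 6 * K) * ε) ≤ m * (δ / 2) := by gcongr
    have h8 : m * δ₀ ≤ m * (δ / 8) := by gcongr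
    have h9 : m * ∫ x, max (‖inner 𝕜 x v'‖ ^ 2 - K) 0 ∂μ ≤ m * (δ / 8) := by gcongr
    rw [abs_le] at h1 h4 h6 ⊢
    constructor <;> linarith [h1.1, h1.2, h4.1, h4.2, h6.1, h6.2]

end Regularity

/-! ### Isotropy from Gaussian characteristic functions. -/

section GaussianChar

/-- The characteristic function of `μ`, regarded as a measure on a real inner product space, is
`exp (-σ ‖t‖²)`. -/
def HasGaussianChar (𝕜 : Type*) {E : Type*} [RCLike 𝕜] [NormedAddCommGroup E]
    [InnerProductSpace 𝕜 E] [MeasurableSpace E] (μ : Measure E) (σ : ℝ) : Prop :=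
  ∀ t : E, ∫ x, Complex.exp ((RCLike.re (inner 𝕜 x t) : ℝ) * Complex.I) ∂μ
    = Complex.exp (-(σ * ‖t‖ ^ 2 : ℝ))

theorem re_inner_inner {𝕜 E : Type*} [RCLike 𝕜] [NormedAddCommGroup E]
    [InnerProductSpace 𝕜 E] (t : 𝕜) (x v : E) :
    RCLike.re (inner 𝕜 (inner 𝕜 x v) t) = RCLike.re (inner 𝕜 x (star t • v)) := by
  rw [inner_smul_right, RCLike.inner_apply', ← RCLike.conj_re]
  simp [mul_comm]

theorem exists_eq_re_inner {𝕜 : Type*} [RCLike 𝕜] (L : StrongDual ℝ 𝕜) :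
    ∃ t : 𝕜, ∀ x, L x = RCLike.re (inner 𝕜 x t) := by
  refine ⟨(L 1 : ℝ) + (L RCLike.I : ℝ) * RCLike.I, fun x => ?_⟩
  have hx : L x = RCLike.re x * L 1 + RCLike.im x * L RCLike.I := by
    have h : x = (RCLike.re x) • (1 : 𝕜) + (RCLike.im x) • (RCLike.I : 𝕜) := by
      rw [RCLike.real_smul_eq_coe_mul, RCLike.real_smul_eq_coe_mul, mul_one, RCLike.re_add_im]
    conv_lhs => rw [h]
    rw [map_add, map_smul, map_smul, smul_eq_mul, smul_eq_mul]
  rw [hx, RCLike.inner_apply', RCLike.mul_re, RCLike.conj_re, RCLike.conj_im]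
  have h1 : RCLike.im x * RCLike.im (RCLike.I : 𝕜) = RCLike.im x := RCLike.I_im x
  simp only [map_add, RCLike.ofReal_re, RCLike.ofReal_im, RCLike.re_ofReal_mul,
    RCLike.im_ofReal_mul, RCLike.I_re, mul_zero, add_zero, zero_add]
  linear_combination (-L RCLike.I) * h1

variable {𝕜 E : Type*} [RCLike 𝕜] [MeasurableSpace 𝕜] [BorelSpace 𝕜]
  [NormedAddCommGroup E] [InnerProductSpace 𝕜 E] [MeasurableSpace E] [BorelSpace E]

/-- The characteristic function of (⟨x,z⟩, ⟨x,v⟩) at (t₁, t₂) is that of μ at t̄₁z + t̄₂v. For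
orthonormal z, v the squared norm there is |t₁|² + |t₂|², so the Gaussian factorizes, and
characteristic functions determine finite measures. -/
theorem HasGaussianChar.isIsotropic {ν : Measure 𝕜} {μ : Measure E} [IsFiniteMeasure ν]
    [IsFiniteMeasure μ] {σ : ℝ} (hν : HasGaussianChar 𝕜 ν σ) (hμ : HasGaussianChar 𝕜 μ σ) :
    IsIsotropic ν μ := by
  refine ⟨fun v hv => ?_, fun z v hz hv hzv => ?_⟩
  · refine Measure.ext_of_charFunDual (funext fun L => ?_)
    obtain ⟨t, ht⟩ := exists_eq_re_inner L
    rw [charFunDual_apply, charFunDual_apply,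
      integral_map (measurable_inner_right v).aemeasurable (by fun_prop)]
    simp_rw [ht, re_inner_inner]
    rw [hμ, hν, norm_smul, norm_star, hv, mul_one]
  · refine Measure.ext_of_charFunDual (funext fun L => ?_)
    obtain ⟨t₁, ht₁⟩ := exists_eq_re_inner (L.comp (ContinuousLinearMap.inl ℝ 𝕜 𝕜))
    obtain ⟨t₂, ht₂⟩ := exists_eq_re_inner (L.comp (ContinuousLinearMap.inr ℝ 𝕜 𝕜))
    rw [charFunDual_prod, charFunDual_apply, charFunDual_apply, charFunDual_apply,
      integral_map ((measurable_inner_right z).prodMk (measurable_inner_right v)).aemeasurable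
        (by fun_prop)]
    have hL : ∀ p : 𝕜 × 𝕜, L p = RCLike.re (inner 𝕜 p.1 t₁) + RCLike.re (inner 𝕜 p.2 t₂) :=
      fun p => by
        rw [← ht₁, ← ht₂, ContinuousLinearMap.comp_apply, ContinuousLinearMap.comp_apply,
          ← map_add]
        simp
    simp_rw [ht₁, ht₂, hL, re_inner_inner, ← map_add, ← inner_add_right]
    rw [hμ, hν, hν, ← Complex.exp_add]
    have horth : inner 𝕜 (star t₁ • z) (star t₂ • v) = 0 := by
      rw [inner_smul_left, inner_smul_right, hzv]; simp
    have := norm_add_sq_eq_norm_sq_add_norm_sq_of_inner_eq_zero _ _ horth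
    rw [norm_smul, norm_smul, hz, hv, norm_star, norm_star, mul_one, mul_one] at this
    have h2 : ‖star t₁ • z + star t₂ • v‖ ^ 2 = ‖t₁‖ ^ 2 + ‖t₂‖ ^ 2 := by rw [sq, this]; ring
    rw [h2]
    congr 1
    push_cast
    ring

end GaussianChar

/-! ### The scalar models: real and complex normal variables. -/

section Scalar

open Complex in
/-- The standard complex normal distribution. -/
noncomputable def complexNormal : Measure ℂ :=
  ((gaussianReal 0 (1 / 2)).prod (gaussianReal 0 (1 / 2))).map (fun p => (p.1 : ℂ) + I * (p.2 : ℂ))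

theorem measurable_add_I_mul : Measurable (fun p : ℝ × ℝ => (p.1 : ℂ) + Complex.I * (p.2 : ℂ)) := by
  fun_prop

instance : IsProbabilityMeasure complexNormal :=
  Measure.isProbabilityMeasure_map measurable_add_I_mul.aemeasurable

theorem hasGaussianChar_gaussianReal : HasGaussianChar ℝ (gaussianReal 0 1) (1 / 2) := by
  intro t
  have := charFun_gaussianReal (μ := 0) (v := 1) t
  rw [charFun_apply] at this
  simp only [RCLike.re_to_real]
  refine this.trans ?_
  congr 1
  rw [Real.norm_eq_abs, sq_abs]
  push_cast
  ring

theorem hasGaussianChar_complexNormal : HasGaussianChar ℂ complexNormal (1 / 4) := by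
  intro t
  rw [complexNormal, integral_map measurable_add_I_mul.aemeasurable (by fun_prop)]
  have h1 : ∀ p : ℝ × ℝ,
      Complex.exp ((RCLike.re (inner ℂ ((p.1 : ℂ) + Complex.I * (p.2 : ℂ)) t) : ℝ)
        * Complex.I)
      = Complex.exp (t.re * p.1 * Complex.I) * Complex.exp (t.im * p.2 * Complex.I) := fun p => by
    rw [← Complex.exp_add, ← add_mul]
    congr 2
    rw [RCLike.inner_apply']
    simp
    ring
  simp_rw [h1]
  rw [integral_prod_mul (fun x : ℝ => Complex.exp (t.re * x * Complex.I))
    (fun x : ℝ => Complex.exp (t.im * x * Complex.I)), ← charFun_apply_real, ← charFun_apply_real,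
    charFun_gaussianReal, charFun_gaussianReal, ← Complex.exp_add, Complex.sq_norm,
    Complex.normSq_apply]
  congr 1
  push_cast
  ring

theorem isOpenPosMeasure_gaussianReal {v : NNReal} (hv : v ≠ 0) :
    (gaussianReal 0 v).IsOpenPosMeasure :=
  (gaussianReal_absolutelyContinuous' 0 hv).isOpenPosMeasure

theorem integral_sq_gaussianReal (v : NNReal) : ∫ x, x ^ 2 ∂(gaussianReal 0 v) = v := by
  have := variance_fun_id_gaussianReal (μ := 0) (v := v)
  rw [variance_of_integral_eq_zero (by fun_prop) (by simp)] at this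
  exact this

theorem exists_isScalarModel_gaussianReal : ∃ s, IsScalarModel (gaussianReal 0 1) s := by
  obtain ⟨s, hs, hi⟩ := IsGaussian.exists_integrable_exp_sq (gaussianReal 0 1)
  refine ⟨s, inferInstance, isOpenPosMeasure_gaussianReal one_ne_zero, ?_, ?_, hs, hi⟩
  · have := gaussianReal_map_neg (μ := 0) (v := 1)
    simpa using this
  · simp_rw [Real.norm_eq_abs, sq_abs]
    simpa using integral_sq_gaussianReal 1

theorem exists_isScalarModel_complexNormal : ∃ s, IsScalarModel complexNormal s := by
  have hhalf : (1 / 2 : NNReal) ≠ 0 := by norm_num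
  have := isOpenPosMeasure_gaussianReal hhalf
  obtain ⟨s, hs, hi⟩ := IsGaussian.exists_integrable_exp_sq (gaussianReal 0 (1 / 2))
  have hn : ∀ p : ℝ × ℝ, ‖(p.1 : ℂ) + Complex.I * (p.2 : ℂ)‖ ^ 2 = p.1 ^ 2 + p.2 ^ 2 := fun p => by
    rw [Complex.sq_norm, Complex.normSq_apply]; simp; ring
  have hsq : Integrable (fun x : ℝ => x ^ 2) (gaussianReal 0 (1 / 2)) :=
    (memLp_id_gaussianReal 2).integrable_sq
  refine ⟨s, inferInstance, ⟨fun U hU hne => ?_⟩, ?_, ?_, hs, ?_⟩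
  · have hcont : Continuous (fun p : ℝ × ℝ => (p.1 : ℂ) + Complex.I * (p.2 : ℂ)) := by fun_prop
    rw [complexNormal, Measure.map_apply measurable_add_I_mul hU.measurableSet]
    obtain ⟨x, hx⟩ := hne
    exact (hU.preimage hcont).measure_ne_zero _
      ⟨(x.re, x.im), by simpa [mul_comm Complex.I] using hx⟩
  · rw [complexNormal, Measure.map_map measurable_neg measurable_add_I_mul]
    have hg : (gaussianReal 0 (1 / 2)).map (fun x => -x) = gaussianReal 0 (1 / 2) := by
      have := gaussianReal_map_neg (μ := 0) (v := 1 / 2)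
      simpa using this
    have hp : ((gaussianReal 0 (1 / 2)).prod (gaussianReal 0 (1 / 2))).map
        (Prod.map (fun x : ℝ => -x) (fun x : ℝ => -x))
        = (gaussianReal 0 (1 / 2)).prod (gaussianReal 0 (1 / 2)) := by
      rw [← Measure.map_prod_map _ _ measurable_neg measurable_neg, hg]
    conv_rhs => rw [← hp, Measure.map_map measurable_add_I_mul (by fun_prop)]
    congr 1
    ext p
    simp
    ring
  · rw [complexNormal, integral_map measurable_add_I_mul.aemeasurable (by fun_prop)]
    simp_rw [hn]
    rw [integral_add (hsq.comp_fst _) (hsq.comp_snd _), integral_fun_fst (fun x : ℝ => x ^ 2),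
      integral_fun_snd (fun x : ℝ => x ^ 2), integral_sq_gaussianReal]
    simp
    norm_num
  · rw [complexNormal, integrable_map_measure (by fun_prop) measurable_add_I_mul.aemeasurable]
    simp only [Function.comp_def, hn, mul_add, Real.exp_add]
    have hi' : Integrable (fun x : ℝ => Real.exp (s * x ^ 2)) (gaussianReal 0 (1 / 2)) := by
      simpa using hi
    exact hi'.mul_prod hi'

end Scalar

/-! ### Characteristic functions of the Gaussian vector models. -/

section Vector

theorem hasGaussianChar_multivariateGaussian (n : ℕ) :
    HasGaussianChar ℝ (multivariateGaussian (0 : EuclideanSpace ℝ (Fin n)) 1) (1 / 2) := by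
  intro t
  have := charFun_stdGaussian (E := EuclideanSpace ℝ (Fin n)) t
  rw [charFun_apply] at this
  rw [multivariateGaussian_zero_one]
  simp only [RCLike.re_to_real]
  refine this.trans ?_
  congr 1
  push_cast
  ring

theorem measurable_toLp_add_I_mul (n : ℕ) :
    Measurable (fun p : EuclideanSpace ℝ (Fin n) × EuclideanSpace ℝ (Fin n) =>
      (WithLp.toLp 2 (fun k => (p.1 k : ℂ) + Complex.I * (p.2 k : ℂ)) :
        EuclideanSpace ℂ (Fin n))) := by
  fun_prop

instance (n : ℕ) : IsProbabilityMeasure (complexGaussian n) :=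
  Measure.isProbabilityMeasure_map (measurable_toLp_add_I_mul n).aemeasurable

theorem hasGaussianChar_complexGaussian (n : ℕ) :
    HasGaussianChar ℂ (complexGaussian n) (1 / 4) := by
  intro t
  have hS : ((1 / 2 : ℝ) • (1 : Matrix (Fin n) (Fin n) ℝ)).PosSemidef :=
    Matrix.PosSemidef.one.smul (by norm_num)
  rw [complexGaussian, integral_map (measurable_toLp_add_I_mul n).aemeasurable (by fun_prop)]
  set tr : EuclideanSpace ℝ (Fin n) := WithLp.toLp 2 fun k => (t k).re with htr
  set ti : EuclideanSpace ℝ (Fin n) := WithLp.toLp 2 fun k => (t k).im with hti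
  have h1 : ∀ p : EuclideanSpace ℝ (Fin n) × EuclideanSpace ℝ (Fin n),
      Complex.exp ((RCLike.re (inner ℂ (WithLp.toLp 2 (fun k => (p.1 k : ℂ)
        + Complex.I * (p.2 k : ℂ)) : EuclideanSpace ℂ (Fin n)) t) : ℝ) * Complex.I)
      = Complex.exp ((inner ℝ p.1 tr : ℝ) * Complex.I)
        * Complex.exp ((inner ℝ p.2 ti : ℝ) * Complex.I) := fun p => by
    rw [← Complex.exp_add, ← add_mul]
    congr 2
    rw [← Complex.ofReal_add]
    congr 1
    rw [PiLp.inner_apply, PiLp.inner_apply, PiLp.inner_apply, map_sum, ← Finset.sum_add_distrib]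
    refine Finset.sum_congr rfl fun k _ => ?_
    rw [RCLike.inner_apply']
    simp [htr, hti, mul_comm]
  simp_rw [h1]
  rw [integral_prod_mul (fun x : EuclideanSpace ℝ (Fin n) =>
      Complex.exp ((inner ℝ x tr : ℝ) * Complex.I))
    (fun x : EuclideanSpace ℝ (Fin n) => Complex.exp ((inner ℝ x ti : ℝ) * Complex.I)),
    ← charFun_apply, ← charFun_apply, charFun_multivariateGaussian hS,
    charFun_multivariateGaussian hS, ← Complex.exp_add]
  have hq : ∀ x : EuclideanSpace ℝ (Fin n),
      dotProduct x.ofLp (((1 / 2 : ℝ) • (1 : Matrix (Fin n) (Fin n) ℝ)).mulVec x.ofLp)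
        = 1 / 2 * ∑ k, x k ^ 2 := fun x => by
    rw [Matrix.smul_mulVec, Matrix.one_mulVec, dotProduct_smul, smul_eq_mul, dotProduct]
    simp only [sq]
  rw [EuclideanSpace.norm_sq_eq]
  have hnt : ∑ k, ‖t k‖ ^ 2 = ∑ k, tr k ^ 2 + ∑ k, ti k ^ 2 := by
    rw [← Finset.sum_add_distrib]
    refine Finset.sum_congr rfl fun k _ => ?_
    rw [Complex.sq_norm, Complex.normSq_apply]
    simp only [htr, hti]
    ring
  rw [hnt, hq, hq]
  simp only [inner_zero_right]
  congr 1
  push_cast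
  ring

end Vector

/-! ### Polar decomposition of Gaussians and transfer to spheres. -/

section Polar

theorem measurable_smul_sphere {E : Type*} [NormedAddCommGroup E] [NormedSpace ℝ E]
    [MeasurableSpace E] [BorelSpace E] :
    Measurable (fun p : Metric.sphere (0 : E) 1 × Set.Ioi (0 : ℝ) => (p.2 : ℝ) • (p.1 : E)) := by
  have : Continuous
      (fun p : Metric.sphere (0 : E) 1 × Set.Ioi (0 : ℝ) => (p.2 : ℝ) • (p.1 : E)) := by fun_prop
  exact this.measurable

variable {E : Type*} [NormedAddCommGroup E] [InnerProductSpace ℝ E] [FiniteDimensional ℝ E]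
  [MeasurableSpace E] [BorelSpace E]

/-- The probability measure with density proportional to `exp (-b ‖x‖²)`. -/
noncomputable def gaussianDensity (E : Type*) [NormedAddCommGroup E] [InnerProductSpace ℝ E]
    [FiniteDimensional ℝ E] [MeasurableSpace E] [BorelSpace E] (b : ℝ) : Measure E :=
  ((volume.withDensity fun x : E => ENNReal.ofReal (Real.exp (-b * ‖x‖ ^ 2))) Set.univ)⁻¹ •
    volume.withDensity fun x : E => ENNReal.ofReal (Real.exp (-b * ‖x‖ ^ 2))

/-- The Bochner integral of a nonintegrable function is 0 by convention, whereas the known value of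
this one is positive. -/
theorem integrable_exp_neg_mul_sq_norm {b : ℝ} (hb : 0 < b) :
    Integrable (fun x : E => Real.exp (-b * ‖x‖ ^ 2)) := by
  by_contra h
  have h1 := GaussianFourier.integral_rexp_neg_mul_sq_norm (V := E) hb
  rw [integral_undef h] at h1
  have : 0 < (Real.pi / b) ^ ((Module.finrank ℝ E : ℝ) / 2) := by positivity
  linarith

theorem withDensity_exp_univ {b : ℝ} (hb : 0 < b) :
    (volume.withDensity fun x : E => ENNReal.ofReal (Real.exp (-b * ‖x‖ ^ 2))) Set.univ
      = ENNReal.ofReal ((Real.pi / b) ^ ((Module.finrank ℝ E : ℝ) / 2)) := by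
  rw [withDensity_apply _ MeasurableSet.univ, Measure.restrict_univ,
    ← ofReal_integral_eq_lintegral_ofReal (integrable_exp_neg_mul_sq_norm hb)
      (ae_of_all _ fun x => (Real.exp_pos _).le), GaussianFourier.integral_rexp_neg_mul_sq_norm hb]

theorem withDensity_exp_univ_ne {b : ℝ} (hb : 0 < b) :
    (volume.withDensity fun x : E => ENNReal.ofReal (Real.exp (-b * ‖x‖ ^ 2))) Set.univ ≠ 0 ∧
    (volume.withDensity fun x : E => ENNReal.ofReal (Real.exp (-b * ‖x‖ ^ 2))) Set.univ ≠ ⊤ := by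
  rw [withDensity_exp_univ hb]
  exact ⟨(ENNReal.ofReal_pos.2 (by positivity)).ne', ENNReal.ofReal_ne_top⟩

theorem isProbabilityMeasure_gaussianDensity {b : ℝ} (hb : 0 < b) :
    IsProbabilityMeasure (gaussianDensity E b) := by
  refine ⟨?_⟩
  rw [gaussianDensity, Measure.smul_apply, smul_eq_mul]
  exact ENNReal.inv_mul_cancel (withDensity_exp_univ_ne hb).1 (withDensity_exp_univ_ne hb).2

theorem charFun_gaussianDensity {b : ℝ} (hb : 0 < b) (t : E) :
    ∫ x, Complex.exp ((inner ℝ x t : ℝ) * Complex.I) ∂(gaussianDensity E b)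
      = Complex.exp (-(1 / (4 * b) * ‖t‖ ^ 2 : ℝ)) := by
  set Z : ℝ := (Real.pi / b) ^ ((Module.finrank ℝ E : ℝ) / 2) with hZ
  have hZpos : 0 < Z := by positivity
  rw [gaussianDensity, integral_smul_measure, withDensity_exp_univ hb]
  simp only [ENNReal.ofReal]
  rw [integral_withDensity_eq_integral_smul (by fun_prop)]
  have h1 : ∀ x : E,
      (Real.exp (-b * ‖x‖ ^ 2)).toNNReal • Complex.exp ((inner ℝ x t : ℝ) * Complex.I)
      = Complex.exp (-b * ‖x‖ ^ 2 + Complex.I * (inner ℝ t x : ℝ)) := fun x => by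
    rw [NNReal.smul_def, Real.coe_toNNReal _ (Real.exp_pos _).le, Complex.real_smul,
      Complex.ofReal_exp, ← Complex.exp_add, real_inner_comm]
    congr 1
    push_cast
    ring
  simp_rw [h1]
  rw [GaussianFourier.integral_cexp_neg_mul_sq_norm_add (by simpa using hb), ← hZ]
  have h2 : ((Real.pi : ℂ) / b) ^ ((Module.finrank ℝ E : ℂ) / 2) = (Z : ℂ) := by
    rw [hZ, Complex.ofReal_cpow (by positivity)]
    push_cast
    rfl
  rw [h2]
  simp only [ENNReal.toReal_inv, ENNReal.coe_toReal, Real.coe_toNNReal _ hZpos.le]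
  rw [Complex.real_smul, ← mul_assoc, ← Complex.ofReal_mul, inv_mul_cancel₀ hZpos.ne',
    Complex.ofReal_one, one_mul]
  congr 1
  rw [Complex.I_sq]
  have : (b : ℂ) ≠ 0 := by exact_mod_cast hb.ne'
  push_cast
  field_simp

/-- The uniform distribution on the unit sphere. -/
noncomputable def unitSphereLaw (E : Type*) [NormedAddCommGroup E] [NormedSpace ℝ E]
    [MeasureSpace E] : Measure (Metric.sphere (0 : E) 1) :=
  ((volume : Measure E).toSphere Set.univ)⁻¹ • (volume : Measure E).toSphere

/-- Polar coordinates on the complement of the origin, which is a null set: a radial density affects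
only the radial factor. -/
theorem withDensity_norm_eq_map [Nontrivial E] {g : ℝ → ENNReal} (hg : Measurable g) :
    (volume : Measure E).withDensity (fun x => g ‖x‖)
      = ((volume : Measure E).toSphere.prod ((Measure.volumeIoiPow
        (Module.finrank ℝ E - 1)).withDensity fun r => g r)).map
          (fun p => (p.2 : ℝ) • (p.1 : E)) := by
  have hgi : Measurable fun r : Set.Ioi (0 : ℝ) => g r := hg.comp measurable_subtype_coe
  ext A hA
  rw [withDensity_apply _ hA, Measure.map_apply measurable_smul_sphere hA,
    prod_withDensity_right hgi, withDensity_apply _ (measurable_smul_sphere hA),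
    ← lintegral_indicator hA, ← lintegral_indicator (measurable_smul_sphere hA)]
  conv_lhs => rw [← restrict_compl_singleton (μ := (volume : Measure E)) 0,
    ← lintegral_subtype_comap (measurableSet_singleton _).compl]
  have hm : Measurable ((fun p : Metric.sphere (0 : E) 1 × Set.Ioi (0 : ℝ) =>
      (p.2 : ℝ) • (p.1 : E)) ⁻¹' A |>.indicator fun p => g p.2) :=
    (hg.comp (measurable_subtype_coe.comp measurable_snd)).indicator (measurable_smul_sphere hA)
  rw [← (volume : Measure E).measurePreserving_homeomorphUnitSphereProd.lintegral_comp hm]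
  refine lintegral_congr fun x => ?_
  have hx : ((homeomorphUnitSphereProd E x).2 : ℝ) • ((homeomorphUnitSphereProd E x).1 : E)
      = (x : E) := by
    rw [← homeomorphUnitSphereProd_symm_apply_coe, Homeomorph.symm_apply_apply]
  have hn : ((homeomorphUnitSphereProd E x).2 : ℝ) = ‖(x : E)‖ :=
    homeomorphUnitSphereProd_apply_snd_coe E x
  by_cases hxA : (x : E) ∈ A
  · rw [Set.indicator_of_mem hxA, Set.indicator_of_mem (by rwa [Set.mem_preimage, hx]), hn]
  · rw [Set.indicator_of_notMem hxA, Set.indicator_of_notMem (by rwa [Set.mem_preimage, hx])]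

/-- The total mass of the unnormalized Gaussian is the product of the masses of its angular and
radial factors, so each factor can be normalized separately. Direction and radius are thus
independent. -/
theorem exists_gaussianDensity_eq_map [Nontrivial E] {b : ℝ} (hb : 0 < b) :
    ∃ ρ : Measure (Set.Ioi (0 : ℝ)), IsProbabilityMeasure ρ ∧
      gaussianDensity E b
        = ((unitSphereLaw E).prod ρ).map (fun p => (p.2 : ℝ) • (p.1 : E)) := by
  set ρ₀ := (Measure.volumeIoiPow (Module.finrank ℝ E - 1)).withDensity
    fun r => ENNReal.ofReal (Real.exp (-b * (r : ℝ) ^ 2)) with hρ₀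
  set τ := (volume : Measure E).toSphere with hτ
  have heq := withDensity_norm_eq_map (E := E)
    (g := fun r => ENNReal.ofReal (Real.exp (-b * r ^ 2))) (by fun_prop)
  rw [← hτ, ← hρ₀] at heq
  have hτ0 : τ Set.univ ≠ 0 := by
    rw [Ne, Measure.measure_univ_eq_zero]; exact Measure.toSphere_ne_zero _
  have hτt : τ Set.univ ≠ ⊤ := measure_ne_top _ _
  have hZ := withDensity_exp_univ_ne (E := E) hb
  have hmass : (volume.withDensity fun x : E => ENNReal.ofReal (Real.exp (-b * ‖x‖ ^ 2))) Set.univ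
      = τ Set.univ * ρ₀ Set.univ := by
    rw [heq, Measure.map_apply measurable_smul_sphere MeasurableSet.univ, Set.preimage_univ,
      ← Set.univ_prod_univ, Measure.prod_prod]
  rw [hmass] at hZ
  have hρ0 : ρ₀ Set.univ ≠ 0 := right_ne_zero_of_mul hZ.1
  have hρt : ρ₀ Set.univ ≠ ⊤ := fun h => hZ.2 (by rw [h, ENNReal.mul_top hτ0])
  refine ⟨(ρ₀ Set.univ)⁻¹ • ρ₀, ⟨?_⟩, ?_⟩
  · rw [Measure.smul_apply, smul_eq_mul, ENNReal.inv_mul_cancel hρ0 hρt]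
  · rw [gaussianDensity, hmass, heq, unitSphereLaw, ← hτ, Measure.prod_smul_left,
      Measure.prod_smul_right, smul_smul, Measure.map_smul,
      ENNReal.mul_inv (Or.inl hτ0) (Or.inl hτt)]

theorem isProbabilityMeasure_unitSphereLaw [Nontrivial E] :
    IsProbabilityMeasure (unitSphereLaw E) := by
  refine ⟨?_⟩
  rw [unitSphereLaw, Measure.smul_apply, smul_eq_mul, ENNReal.inv_mul_cancel _ (measure_ne_top _ _)]
  rw [Ne, Measure.measure_univ_eq_zero]
  exact Measure.toSphere_ne_zero _

/-- An event for independent rotation-invariant Gaussian vectors yields an event for independent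
uniform vectors on a sphere, after rescaling the vectors by suitable fixed factors. -/
theorem exists_scaling_uniformSphere [Nontrivial E] {b R : ℝ} (hb : 0 < b) (hR : R ≠ 0) {m : ℕ}
    {G : Set (Fin m → E)} (hG : MeasurableSet G) :
    ∃ c : Fin m → ℝ, (∀ i, c i ≠ 0) ∧
      (Measure.pi fun _ : Fin m => uniformSphere E R).real {a | (fun i => c i • a i) ∈ G}ᶜ
        ≤ (Measure.pi fun _ : Fin m => gaussianDensity E b).real Gᶜ := by
  have := isProbabilityMeasure_unitSphereLaw (E := E)
  obtain ⟨ρ, hρ, heq⟩ := exists_gaussianDensity_eq_map (E := E) hb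
  set Φ : Metric.sphere (0 : E) 1 × Set.Ioi (0 : ℝ) → E := fun p => (p.2 : ℝ) • (p.1 : E) with hΦ
  have hΦm : Measurable Φ := measurable_smul_sphere
  have hprob : IsProbabilityMeasure (((unitSphereLaw E).prod ρ).map Φ) :=
    Measure.isProbabilityMeasure_map hΦm.aemeasurable
  have hpi : Measure.pi (fun _ : Fin m => gaussianDensity E b)
      = (Measure.pi fun _ : Fin m => (unitSphereLaw E).prod ρ).map fun p i => Φ (p i) := by
    rw [Measure.pi_map_pi fun _ => hΦm.aemeasurable, heq]
  set Ψ : (Fin m → Metric.sphere (0 : E) 1) × (Fin m → Set.Ioi (0 : ℝ)) → Fin m → E :=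
    fun q i => (q.2 i : ℝ) • (q.1 i : E) with hΨ
  have hΨm : Measurable Ψ := by
    refine measurable_pi_lambda _ fun i => ?_
    exact hΦm.comp (g := Φ) (f := fun q : (Fin m → Metric.sphere (0 : E) 1)
      × (Fin m → Set.Ioi (0 : ℝ)) => (q.1 i, q.2 i)) (by fun_prop)
  have hmp := measurePreserving_arrowProdEquivProdArrow (Metric.sphere (0 : E) 1)
    (Set.Ioi (0 : ℝ)) (Fin m) (fun _ => unitSphereLaw E) (fun _ => ρ)
  have hpi2 : (Measure.pi fun _ : Fin m => gaussianDensity E b) Gᶜ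
      = ((Measure.pi fun _ : Fin m => unitSphereLaw E).prod (Measure.pi fun _ : Fin m => ρ))
        (Ψ ⁻¹' Gᶜ) := by
    rw [hpi, ← hmp.map_eq, Measure.map_apply (MeasurableEquiv.measurable _) (hΨm hG.compl),
      Measure.map_apply (by fun_prop) hG.compl]
    rfl
  rw [Measure.prod_apply_symm (hΨm hG.compl)] at hpi2
  -- The Gaussian failure probability is an average over the radii, so some fixed vector r of radii
  -- does no worse for uniform directions.
  obtain ⟨r, hr⟩ := exists_le_lintegral (μ := Measure.pi fun _ : Fin m => ρ)
    (measurable_measure_prodMk_right (hΨm hG.compl)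
      (μ := Measure.pi fun _ : Fin m => unitSphereLaw E)).aemeasurable
  rw [← hpi2] at hr
  have hsm : Measurable fun u : Metric.sphere (0 : E) 1 => R • (u : E) := by fun_prop
  have hunif : uniformSphere E R
      = (unitSphereLaw E).map fun u : Metric.sphere (0 : E) 1 => R • (u : E) := rfl
  have hprob2 : IsProbabilityMeasure
      ((unitSphereLaw E).map fun u : Metric.sphere (0 : E) 1 => R • (u : E)) :=
    Measure.isProbabilityMeasure_map hsm.aemeasurable
  have hprob3 : IsProbabilityMeasure (gaussianDensity E b) :=
    isProbabilityMeasure_gaussianDensity hb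
  -- The factor r_i/R carries a point of the sphere of radius R to the chosen radius r_i.
  refine ⟨fun i => (r i : ℝ) / R, fun i => div_ne_zero (ne_of_gt (r i).2) hR, ?_⟩
  have hGm : MeasurableSet {a : Fin m → E | (fun i => ((r i : ℝ) / R) • a i) ∈ G} :=
    hG.preimage (f := fun a : Fin m → E => fun i => ((r i : ℝ) / R) • a i) (by fun_prop)
  refine ENNReal.toReal_mono (measure_ne_top _ _) (le_trans (le_of_eq ?_) hr)
  rw [hunif, ← Measure.pi_map_pi fun _ => hsm.aemeasurable,
    Measure.map_apply (by fun_prop) hGm.compl]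
  congr 1
  ext u
  simp only [Set.mem_preimage, Set.mem_compl_iff, Set.mem_ofPred_eq, hΨ, smul_smul,
    div_mul_cancel₀ _ hR]

end Polar

/-! ### From product measures to arbitrary probability spaces, and degenerate cases. -/

section Transfer

variable {𝕜 : Type*} [RCLike 𝕜] {n m : ℕ}

/-- An event for the product law yields an event on any probability space carrying independent
vectors with that law. -/
theorem exactForAllWithProbability_of_pi [MeasurableSpace 𝕜] {Ω : Type*} [MeasurableSpace Ω]
    {P : Measure Ω} [IsProbabilityMeasure P] {μ : Measure (EuclideanSpace 𝕜 (Fin n))} [IsProbabilityMeasure μ]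
    {a : Fin m → Ω → EuclideanSpace 𝕜 (Fin n)} (hlaw : ∀ i, HasLaw (a i) μ P)
    (hind : iIndepFun a P) {G : Set (Fin m → EuclideanSpace 𝕜 (Fin n))} (hG : MeasurableSet G)
    {η : ℝ} (hη : (Measure.pi fun _ : Fin m => μ).real Gᶜ ≤ η)
    (hex : ∀ x ∈ G, ∀ x₀, IsExact x x₀) : ExactForAllWithProbability P a η := by
  have hmeas : ∀ i, AEMeasurable (a i) P := fun i => (hlaw i).aemeasurable
  have hA : AEMeasurable (fun ω i => a i ω) P := aemeasurable_pi_iff.2 hmeas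
  have hmap : P.map (fun ω i => a i ω) = Measure.pi fun _ : Fin m => μ := by
    rw [(iIndepFun_iff_map_fun_eq_pi_map hmeas).1 hind]
    congr 1
    funext i
    exact (hlaw i).map_eq
  -- The vectors are only almost everywhere measurable, so the preimage of G is merely
  -- null-measurable; a measurable subset of equal measure replaces it.
  obtain ⟨S, hS, hSm, hSae⟩ := (hA.nullMeasurableSet_preimage hG).exists_measurable_subset_ae_eq
  refine ⟨S, hSm, ?_, fun ω hω x₀ => hex _ (hS hω) x₀⟩
  have h1 : P.real S = (Measure.pi fun _ : Fin m => μ).real G := by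
    rw [measureReal_congr hSae, ← hmap, measureReal_def, measureReal_def,
      Measure.map_apply_of_aemeasurable hA hG]
  rw [h1]
  have h2 := probReal_compl_eq_one_sub (μ := Measure.pi fun _ : Fin m => μ) hG
  linarith

theorem exactForAllWithProbability_of_one_le {Ω : Type*} [MeasurableSpace Ω] {P : Measure Ω}
    (a : Fin m → Ω → EuclideanSpace 𝕜 (Fin n)) {η : ℝ} (hη : 1 ≤ η) :
    ExactForAllWithProbability P a η :=
  ⟨∅, MeasurableSet.empty, by simpa using hη, fun ω hω => absurd hω (Set.notMem_empty ω)⟩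

theorem exactForAllWithProbability_zero {Ω : Type*} [MeasurableSpace Ω] {P : Measure Ω}
    [IsProbabilityMeasure P] (a : Fin m → Ω → EuclideanSpace 𝕜 (Fin 0)) {η : ℝ} (hη : 0 ≤ η) :
    ExactForAllWithProbability P a η :=
  ⟨Set.univ, MeasurableSet.univ, by simpa using hη,
    fun _ _ _ => isExact_of_feasibleSet_subset fun _ _ => Subsingleton.elim _ _⟩

end Transfer

/-- Exact recovery with overwhelming probability for all isotropic Gaussian vectors. -/
theorem exists_exact_event {𝕜 : Type*} [RCLike 𝕜] [MeasurableSpace 𝕜] [BorelSpace 𝕜]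
    {ν : Measure 𝕜} {s σ : ℝ} (hν : IsScalarModel ν s) (hνc : HasGaussianChar 𝕜 ν σ) :
    ∃ c₀ γ : ℝ, 0 < c₀ ∧ 0 < γ ∧ ∀ n m : ℕ, 0 < m → c₀ * n ≤ m →
      ∀ μ : Measure (EuclideanSpace 𝕜 (Fin n)), IsProbabilityMeasure μ → HasGaussianChar 𝕜 μ σ →
      ∃ G : Set (Fin m → EuclideanSpace 𝕜 (Fin n)), MeasurableSet G ∧
        (Measure.pi fun _ : Fin m => μ).real Gᶜ ≤ 8 * Real.exp (-γ * m) ∧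
        ∀ a ∈ G, ∀ x₀, IsExact a x₀ := by
  obtain ⟨c₀, γ, c₁, c₂, δ, hc₀, hγ, hc₁, hδ, hc₂, h⟩ := exists_regular_event hν
  have := hν.isProbabilityMeasure
  -- The factor 2 covers the real dimension of 𝕜ⁿ, which is at most 2n.
  refine ⟨2 * c₀, γ, by positivity, hγ, fun n m hm hnm μ _ hμ => ?_⟩
  have hdim : (Module.finrank ℝ (EuclideanSpace 𝕜 (Fin n)) : ℝ) ≤ 2 * n := by
    have h1 : Module.finrank ℝ (EuclideanSpace 𝕜 (Fin n))
        = Module.finrank ℝ 𝕜 * n := by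
      rw [← Module.finrank_mul_finrank ℝ 𝕜 (EuclideanSpace 𝕜 (Fin n)), finrank_euclideanSpace_fin]
    have h2 : Module.finrank ℝ 𝕜 ≤ 2 := RCLike.finrank_le_two 𝕜
    rw [h1]
    push_cast
    have : (Module.finrank ℝ 𝕜 : ℝ) ≤ 2 := by exact_mod_cast h2
    gcongr
  obtain ⟨G, hG, hGp, hGr⟩ := h (EuclideanSpace 𝕜 (Fin n)) μ (hνc.isIsotropic hμ) m (by nlinarith)
  exact ⟨G, hG, hGp, fun a ha x₀ => (hGr a ha).isExact hm hc₁ hδ.le hc₂ x₀⟩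

theorem hasGaussianChar_gaussianDensity_real (n : ℕ) :
    HasGaussianChar ℝ (gaussianDensity (EuclideanSpace ℝ (Fin n)) (1 / 2)) (1 / 2) := by
  intro t
  simp only [RCLike.re_to_real]
  rw [charFun_gaussianDensity (by norm_num)]
  norm_num

theorem hasGaussianChar_gaussianDensity_complex (n : ℕ) :
    HasGaussianChar ℂ (gaussianDensity (EuclideanSpace ℂ (Fin n)) 1) (1 / 4) := by
  intro t
  have h : ∀ x y : EuclideanSpace ℂ (Fin n), RCLike.re (inner ℂ x y) = (inner ℝ x y : ℝ) :=
    fun x y => by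
      rw [PiLp.inner_apply, PiLp.inner_apply, map_sum]
      rfl
  simp_rw [h]
  rw [charFun_gaussianDensity (by norm_num)]
  norm_num

end PhaseLift

theorem theorem2 :
    ∃ c₀ γ C : ℝ, 0 < c₀ ∧ 0 < γ ∧ 0 < C ∧
      ∀ (n m : ℕ), c₀ * (n : ℝ) ≤ (m : ℝ) →
      ∀ (Ω : Type*) [MeasurableSpace Ω] (P : Measure Ω) [IsProbabilityMeasure P],
        (∀ μ : Measure (EuclideanSpace ℝ (Fin n)), PhaseLift.IsRealModel n μ →
          ∀ a : Fin m → Ω → EuclideanSpace ℝ (Fin n),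
            (∀ i, HasLaw (a i) μ P) → iIndepFun a P →
            PhaseLift.ExactForAllWithProbability P a (C * Real.exp (-γ * (m : ℝ)))) ∧
        (∀ μ : Measure (EuclideanSpace ℂ (Fin n)), PhaseLift.IsComplexModel n μ →
          ∀ a : Fin m → Ω → EuclideanSpace ℂ (Fin n),
            (∀ i, HasLaw (a i) μ P) → iIndepFun a P →
            PhaseLift.ExactForAllWithProbability P a (C * Real.exp (-γ * (m : ℝ)))) := by
  obtain ⟨s₁, hs₁⟩ := PhaseLift.exists_isScalarModel_gaussianReal
  obtain ⟨s₂, hs₂⟩ := PhaseLift.exists_isScalarModel_complexNormal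
  obtain ⟨c₁, γ₁, hc₁, hγ₁, hreal⟩ :=
    PhaseLift.exists_exact_event hs₁ PhaseLift.hasGaussianChar_gaussianReal
  obtain ⟨c₂, γ₂, hc₂, hγ₂, hcomplex⟩ :=
    PhaseLift.exists_exact_event hs₂ PhaseLift.hasGaussianChar_complexNormal
  refine ⟨max c₁ c₂, min γ₁ γ₂, 8, lt_max_of_lt_left hc₁, lt_min hγ₁ hγ₂, by norm_num,
    fun n m hnm Ω _ P _ => ?_⟩
  -- For m = 0 the probability bound is vacuous, as 8 ≥ 1; for n = 0 all matrices coincide.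
  rcases Nat.eq_zero_or_pos m with rfl | hm
  · have h8 : 1 ≤ 8 * Real.exp (-min γ₁ γ₂ * ((0 : ℕ) : ℝ)) := by simp
    exact ⟨fun _ _ a _ _ => PhaseLift.exactForAllWithProbability_of_one_le a h8,
      fun _ _ a _ _ => PhaseLift.exactForAllWithProbability_of_one_le a h8⟩
  rcases Nat.eq_zero_or_pos n with rfl | hn
  · have h8 : 0 ≤ 8 * Real.exp (-min γ₁ γ₂ * (m : ℝ)) := by positivity
    exact ⟨fun _ _ a _ _ => PhaseLift.exactForAllWithProbability_zero a h8,
      fun _ _ a _ _ => PhaseLift.exactForAllWithProbability_zero a h8⟩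
  have hsqrt : Real.sqrt n ≠ 0 := (Real.sqrt_pos.2 (by exact_mod_cast hn)).ne'
  have hne : Nonempty (Fin n) := ⟨⟨0, hn⟩⟩
  have hn0 : (0 : ℝ) ≤ n := n.cast_nonneg
  have hm0 : (0 : ℝ) ≤ m := m.cast_nonneg
  have hnm₁ : c₁ * n ≤ m := (mul_le_mul_of_nonneg_right (le_max_left _ _) hn0).trans hnm
  have hnm₂ : c₂ * n ≤ m := (mul_le_mul_of_nonneg_right (le_max_right _ _) hn0).trans hnm
  have he₁ : 8 * Real.exp (-γ₁ * m) ≤ 8 * Real.exp (-min γ₁ γ₂ * m) := by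
    gcongr; exact min_le_left _ _
  have he₂ : 8 * Real.exp (-γ₂ * m) ≤ 8 * Real.exp (-min γ₁ γ₂ * m) := by
    gcongr; exact min_le_right _ _
  constructor
  · rintro μ (rfl | rfl) a hlaw hind
    · obtain ⟨G, hG, hGp, hGe⟩ := hreal n m hm hnm₁ _ inferInstance
        (PhaseLift.hasGaussianChar_multivariateGaussian n)
      exact PhaseLift.exactForAllWithProbability_of_pi hlaw hind hG (hGp.trans he₁) hGe
    · obtain ⟨G, hG, hGp, hGe⟩ := hreal n m hm hnm₁ _
        (PhaseLift.isProbabilityMeasure_gaussianDensity (by norm_num))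
        (PhaseLift.hasGaussianChar_gaussianDensity_real n)
      -- Density parameter b gives characteristic exponent 1/(4b): b = 1/2 matches the real normal
      -- law, and b = 1 below the complex one.
      obtain ⟨c, hc, hcG⟩ := PhaseLift.exists_scaling_uniformSphere (b := 1 / 2) (by norm_num)
        hsqrt hG
      have hprob : IsProbabilityMeasure
          (PhaseLift.uniformSphere (EuclideanSpace ℝ (Fin n)) (Real.sqrt n)) := by
        rw [← (hlaw ⟨0, hm⟩).map_eq]
        exact Measure.isProbabilityMeasure_map (hlaw ⟨0, hm⟩).aemeasurable
      refine PhaseLift.exactForAllWithProbability_of_pi hlaw hind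
        (hG.preimage (f := fun a : Fin m → EuclideanSpace ℝ (Fin n) => fun i => c i • a i)
          (by fun_prop)) (hcG.trans (hGp.trans he₁)) fun x hx x₀ => ?_
      exact PhaseLift.IsExact.of_smul hc (hGe _ hx x₀)
  · rintro μ (rfl | rfl) a hlaw hind
    · obtain ⟨G, hG, hGp, hGe⟩ := hcomplex n m hm hnm₂ _ inferInstance
        (PhaseLift.hasGaussianChar_complexGaussian n)
      exact PhaseLift.exactForAllWithProbability_of_pi hlaw hind hG (hGp.trans he₂) hGe
    · obtain ⟨G, hG, hGp, hGe⟩ := hcomplex n m hm hnm₂ _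
        (PhaseLift.isProbabilityMeasure_gaussianDensity (by norm_num))
        (PhaseLift.hasGaussianChar_gaussianDensity_complex n)
      obtain ⟨c, hc, hcG⟩ := PhaseLift.exists_scaling_uniformSphere (b := 1) (by norm_num)
        hsqrt hG
      have hprob : IsProbabilityMeasure
          (PhaseLift.uniformSphere (EuclideanSpace ℂ (Fin n)) (Real.sqrt n)) := by
        rw [← (hlaw ⟨0, hm⟩).map_eq]
        exact Measure.isProbabilityMeasure_map (hlaw ⟨0, hm⟩).aemeasurable
      refine PhaseLift.exactForAllWithProbability_of_pi hlaw hind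
        (hG.preimage (f := fun a : Fin m → EuclideanSpace ℂ (Fin n) => fun i => c i • a i)
          (by fun_prop)) (hcG.trans (hGp.trans he₂)) fun x hx x₀ => ?_
      refine PhaseLift.IsExact.of_smul hc ?_
      have := hGe _ hx x₀
      simpa only [RCLike.real_smul_eq_coe_smul (K := ℂ)] using this
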